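/- Let $(k,|\cdot|)$ be a field complete with respect to a multiplicative norm satisfying the ultrametric inequality (the norm may be trivial), and let $C=\widehat{k^{\mathrm{alg}}}$ be the completion of an algebraic closure of $k$. Let $\mathbb A^{1,\mathrm{an}}_k$ be the set of multiplicative seminorms on $k[T]$ extending $|\cdot|$, with the coarsest topology making all maps $x\mapsto |P|_x$, $P\in k[T]$, continuous, and let $\mathbb P^{1,\mathrm{an}}_k=\mathbb A^{1,\mathrm{an}}_k\cup\{\infty\}$ be the Berkovich projective line, which is compact and Hausdorff. For $a\in C$, $r\ge 0$, let $\eta_{a,r}$ be the seminorm $\sum_n a_n(T-a)^n\mapsto\max_n|a_n|r^n$ on $C[T]$, and let $\pi:\mathbb P^{1,\mathrm{an}}_C\to\mathbb P^{1,\mathrm{an}}_k$ be the restriction of seminorms (with $\pi(\infty)=\infty$). A point of $\mathbb P^{1,\mathrm{an}}_k$ is of type 1 if it is $\infty$ or some $\pi(\eta_{a,0})$, and of type 2 or 3 if it is some $\pi(\eta_{a,r})$ with $r>0$. Put $\mathbb H_k=\{x\in\mathbb P^{1,\mathrm{an}}_k: x\text{ is not of type }1\}$. Let $[x,y]$ denote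 the unique injective path joining $x$ and $y$ in $\mathbb P^{1,\mathrm{an}}_k$. The interval length $\rho$ is defined as follows. For $a,b\in C$ and $r,s>0$, set $\rho(\eta_{a,r},\eta_{b,s})=|\log\frac rs|$ if $|a-b|\le\max(r,s)$, and $\rho(\eta_{a,r},\eta_{b,s})=|\log\frac{|a-b|}{r}|+|\log\frac{s}{|a-b|}|$ otherwise. If $x,y\in \mathbb P^{1,\mathrm{an}}_k$ are of type 2 or 3, then $\rho(x,y)=\rho(\eta_{a,r},\eta_{b,s})$ for any path $[\eta_{a,r},\eta_{b,s}]$ in $\mathbb P^{1,\mathrm{an}}_C$ which $\pi$ maps bijectively onto $[x,y]$, with $\pi(\eta_{a,r})=x$ and $\pi(\eta_{b,s})=y$. In general, $\rho(u,v)$ is the supremum of $\rho(x,y)$ over $x,y\in[u,v]$ of type 2 or 3. For $x,y,z\in\mathbb H_k$ let $x\wedge_z y$ be the retraction of $z$ on $[x,y]$, i.e. the point at which the path issued from $z$ first meets $[x,y]$. Fix $\eta\in\mathbb H_k$. The Gromov boundary $\partial_G\mathbb H_k$ is the set of sequences $(x_n)_n$ in $\mathbb H_k$ with $\lim_{n,m\to\infty}\rho(\eta,x_n\wedge_\eta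 x_m)=+\infty$, modulo the equivalence relation $(x_n)_n\sim(y_n)_n$ iff $\lim_{n,m\to\infty}\rho(\eta,x_n\wedge_\eta y_m)=+\infty$. The Gromov compactification is the disjoint union $\mathbb H_k\cup\partial_G\mathbb H_k$ with the following topology: on $\mathbb H_k$ (which is open) the topology induced by $\rho$, and a basis of neighborhoods of $[(x_n)_n]\in\partial_G\mathbb H_k$ is given by the sets $$N_t([(x_n)_n])=\{y\in\mathbb H_k\cup\partial_G\mathbb H_k:\ \liminf_{n,m\to\infty}\rho(\eta,x_n\wedge_\eta y_m)>t\},\qquad t>0,$$ where $y_m=y$ for all $m$ if $y\in\mathbb H_k$, and $(y_m)_m$ is a representative of $y$ if $y\in\partial_G\mathbb H_k$. **Theorem.** For every $\eta\in\mathbb H_k$, the identity map from $(\mathbb H_k,\rho)$ to $\mathbb H_k$ with the Berkovich topology extends to a continuous bijection $\phi:\mathbb H_k\cup\partial_G\mathbb H_k\to\mathbb P^{1,\mathrm{an}}_k$, which sends each $[(x_n)_n]\in\partial_G\mathbb H_k$ to the limit of $(x_n)_n$ in $\mathbb P^{1,\mathrm{an}}_k$ (this limit exists). Moreover, for every sequence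 $(a_n)_n$ in $\mathbb H_k$ and every $a\in\partial_G\mathbb H_k$, the sequence $(a_n)_n$ converges to $a$ in $\mathbb H_k\cup\partial_G\mathbb H_k$ if and only if it converges to $\phi(a)$ in $\mathbb P^{1,\mathrm{an}}_k$. -/

import Mathlib

open Filter Topology Polynomial
open scoped NNReal ENNReal

noncomputable section

namespace BerkovichLine

/-! ### The completion of an algebraic closure -/

/-- An algebraic closure of `k`, to be endowed with the extension of the norm of `k`. -/
def AlgCl (k : Type*) [Field k] : Type _ := AlgebraicClosure k

instance (k : Type*) [Field k] : Field (AlgCl k) := inferInstanceAs (Field (AlgebraicClosure k))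

instance (k : Type*) [Field k] : Algebra k (AlgCl k) :=
  inferInstanceAs (Algebra k (AlgebraicClosure k))

instance (k : Type*) [Field k] : Algebra.IsAlgebraic k (AlgCl k) :=
  inferInstanceAs (Algebra.IsAlgebraic k (AlgebraicClosure k))

/-- The spectral norm over a complete non-Archimedean field is multiplicative, whether or not the
norm of the field is trivial. -/
theorem spectralNorm_mul_eq {k : Type*} [NormedField k] [CompleteSpace k] [IsUltrametricDist k]
    (x y : AlgCl k) :
    spectralNorm k (AlgCl k) (x * y) = spectralNorm k (AlgCl k) x * spectralNorm k (AlgCl k) y := by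
  by_cases h : ∃ c : k, 1 < ‖c‖
  · let _ : NontriviallyNormedField k := { ‹NormedField k› with non_trivial := h }
    exact spectralAlgNorm_mul (K := k) x y
  · push Not at h
    have hle : ∀ z : AlgCl k, spectralNorm k (AlgCl k) z ≤ 1 := fun z =>
      (spectralValue_le_one_iff
        (minpoly.monic (Algebra.IsAlgebraic.isAlgebraic z).isIntegral)).2 fun n => h _
    have hone : ∀ z : AlgCl k, z ≠ 0 → spectralNorm k (AlgCl k) z = 1 := fun z hz => by
      refine le_antisymm (hle z) ?_
      have h1 : (1 : ℝ) ≤ spectralNorm k (AlgCl k) z * spectralNorm k (AlgCl k) z⁻¹ := by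
        have := spectralNorm_mul (K := k) (Algebra.IsAlgebraic.isAlgebraic z)
          (Algebra.IsAlgebraic.isAlgebraic z⁻¹)
        rwa [mul_inv_cancel₀ hz, spectralNorm_one] at this
      nlinarith [hle z⁻¹, spectralNorm_nonneg (K := k) z, spectralNorm_nonneg (K := k) z⁻¹]
    by_cases hx : x = 0
    · simp [hx, spectralNorm_zero]
    by_cases hy : y = 0
    · simp [hy, spectralNorm_zero]
    rw [hone x hx, hone y hy, hone _ (mul_ne_zero hx hy), one_mul]

instance {k : Type*} [NormedField k] [CompleteSpace k] [IsUltrametricDist k] :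
    NormedField (AlgCl k) where
  __ := (inferInstance : Field (AlgCl k))
  norm x := spectralNorm k (AlgCl k) x
  dist x y := spectralNorm k (AlgCl k) (x - y)
  dist_self x := by simp [spectralNorm_zero]
  dist_comm x y := by rw [← neg_sub, spectralNorm_neg (Algebra.IsAlgebraic.isAlgebraic _)]
  dist_triangle x y z :=
    sub_add_sub_cancel x y z ▸ isNonarchimedean_spectralNorm.add_le spectralNorm_nonneg
  eq_of_dist_eq_zero h := sub_eq_zero.1
    (eq_zero_of_map_spectralNorm_eq_zero h (Algebra.IsAlgebraic.isAlgebraic _))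
  dist_eq x y := by
    rw [← spectralNorm_neg (Algebra.IsAlgebraic.isAlgebraic _), neg_sub, sub_eq_neg_add]
  norm_mul x y := spectralNorm_mul_eq x y

instance {k : Type*} [NormedField k] [CompleteSpace k] [IsUltrametricDist k] :
    NormedAlgebra k (AlgCl k) where
  norm_smul_le c x := le_of_eq (spectralNorm_smul c (Algebra.IsAlgebraic.isAlgebraic x))

/-- The completion of an algebraic closure of `k`. -/
abbrev CompletedAlgCl (k : Type*) [NormedField k] [CompleteSpace k] [IsUltrametricDist k] : Type _ :=
  UniformSpace.Completion (AlgCl k)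

instance {k : Type*} [NormedField k] [CompleteSpace k] [IsUltrametricDist k] :
    IsUltrametricDist (CompletedAlgCl k) :=
  IsUltrametricDist.of_normedAlgebra k

/-! ### The Berkovich affine and projective lines -/

/-- The Berkovich analytic affine line: multiplicative seminorms on `K[T]` extending the norm
of `K`. -/
def A1an (K : Type*) [NormedField K] : Type _ :=
  {x : MulRingSeminorm K[X] // ∀ a : K, x (C a) = ‖a‖}

/-- The coarsest topology such that all evaluation maps `x ↦ |P|_x` are continuous. -/
instance (K : Type*) [NormedField K] : TopologicalSpace (A1an K) :=
  TopologicalSpace.induced (fun (x : A1an K) (P : K[X]) => x.1 P) inferInstance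

/-- The Berkovich projective line, `A1an K ∪ {∞}`, with the topology which makes it a
compact space having the locally compact Hausdorff space `A1an K` as an open subspace. -/
abbrev P1an (K : Type*) [NormedField K] : Type _ := OnePoint (A1an K)

/-- The point `η_{a,r}`, i.e. the seminorm `∑ aₙ (T - a)ⁿ ↦ max |aₙ| rⁿ`. The polynomial
`taylor a P` is `P (T + a)`, whose coefficients are those of `P` in the powers of `T - a`. -/
def diskPoint {K : Type*} [NormedField K] [IsUltrametricDist K] (a : K) (r : ℝ≥0) : A1an K :=
  have hna : IsNonarchimedean (NormedField.toAbsoluteValue K) :=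
    fun x y => IsUltrametricDist.norm_add_le_max x y
  ⟨{ toFun := fun P => (taylor a P).gaussNorm (NormedField.toAbsoluteValue K) r
     map_zero' := by simp
     add_le' := fun P Q => by
       rw [map_add]
       exact (isNonarchimedean_gaussNorm _ hna r.2).add_le
         (fun {_} => gaussNorm_nonneg _ _ r.2)
     neg' := fun P => by
       rw [map_neg, ← gaussNorm_coe_powerSeries _ _ r.coe_nonneg,
         ← gaussNorm_coe_powerSeries _ _ r.coe_nonneg,
         PowerSeries.gaussNorm_eq, PowerSeries.gaussNorm_eq]
       simp only [coeff_coe, coeff_neg, AbsoluteValue.map_neg]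
     map_one' := by
       rw [taylor_one, gaussNorm_C, map_one]
     map_mul' := fun P Q => by
       rw [taylor_mul]
       rcases eq_or_ne r 0 with rfl | hr
       · simp [mul_coeff_zero]
       · exact gaussNorm_mul hna (NNReal.coe_pos.2 (pos_iff_ne_zero.2 hr)) _ _ },
   fun c => by
     change (taylor a (C c)).gaussNorm (NormedField.toAbsoluteValue K) r = ‖c‖
     rw [taylor_C, gaussNorm_C]
     rfl⟩

/-- Restriction of seminorms from `L[T]` to `K[T]`. -/
def restrict (K : Type*) [NormedField K] {L : Type*} [NormedField L] [NormedAlgebra K L]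
    (x : A1an L) : A1an K :=
  ⟨{ toFun := fun P => x.1 (P.map (algebraMap K L))
     map_zero' := by simp
     add_le' := fun P Q => by rw [Polynomial.map_add]; exact map_add_le_add x.1 _ _
     neg' := fun P => by rw [Polynomial.map_neg]; exact map_neg_eq_map x.1 _
     map_one' := by simp
     map_mul' := fun P Q => by rw [Polynomial.map_mul]; exact map_mul x.1 _ _ },
   fun a => by
     change x.1 ((C a).map (algebraMap K L)) = ‖a‖
     rw [Polynomial.map_C, x.2, norm_algebraMap']⟩

/-- The projection `P1an L → P1an K`, which restricts seminorms and sends `∞` to `∞`. -/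
def proj (K : Type*) [NormedField K] {L : Type*} [NormedField L] [NormedAlgebra K L] :
    P1an L → P1an K :=
  OnePoint.map (restrict K)

section Hyperbolic

variable {k : Type*} [NormedField k] [CompleteSpace k] [IsUltrametricDist k]

/-- The type 1 points are the images of the points of the projective line over the completed
algebraic closure. -/
def IsTypeOne (x : P1an k) : Prop :=
  x = OnePoint.infty ∨
    ∃ a : CompletedAlgCl k, x = proj k ((diskPoint a 0 : A1an (CompletedAlgCl k)) :
      P1an (CompletedAlgCl k))

variable (k) in
/-- The hyperbolic space over `k`: the points of the projective line which are not of type 1. -/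
def HypSpace : Type _ := {x : P1an k // ¬ IsTypeOne x}

/-! ### Injective paths and the interval length metric -/

/-- The injective path `[x, y]` in the projective line, as a set of points. -/
def arc (x y : P1an k) : Set (P1an k) :=
  {x, y} ∪ {z | ∃ γ : Path x y, Function.Injective γ ∧ z ∈ Set.range γ}

/-- The injective path `[η_{a,r}, η_{b,s}]` over the completed algebraic closure: it goes up
from `η_{a,r}` to `η_{a,R} = η_{b,R}`, where `R = max (r, s, |a - b|)`, and down to `η_{b,s}`. -/
def diskArc (a b : CompletedAlgCl k) (r s : ℝ≥0) : Set (P1an (CompletedAlgCl k)) :=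
  (fun t : ℝ≥0 => ((diskPoint a t : A1an (CompletedAlgCl k)) : P1an (CompletedAlgCl k))) ''
      Set.Icc r (max (max r s) ‖a - b‖₊) ∪
    (fun t : ℝ≥0 => ((diskPoint b t : A1an (CompletedAlgCl k)) : P1an (CompletedAlgCl k))) ''
      Set.Icc s (max (max r s) ‖a - b‖₊)

/-- The length of the path `[η_{a,r}, η_{b,s}]`, for `r, s > 0`. -/
def diskDist (a b : CompletedAlgCl k) (r s : ℝ≥0) : ℝ :=
  if ‖a - b‖ ≤ max (r : ℝ) s then |Real.log (r / s)|
  else |Real.log (‖a - b‖ / r)| + |Real.log (s / ‖a - b‖)|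

/-- The points `x`, `y` of type 2 or 3 have distance `d`: the path `[x, y]` lifts to a path
`[η_{a,r}, η_{b,s}]` over the completed algebraic closure, whose length is `d`. -/
def HasLength (x y : P1an k) (d : ℝ) : Prop :=
  ∃ (a b : CompletedAlgCl k) (r s : ℝ≥0), 0 < r ∧ 0 < s ∧
    proj k ((diskPoint a r : A1an (CompletedAlgCl k)) : P1an (CompletedAlgCl k)) = x ∧
    proj k ((diskPoint b s : A1an (CompletedAlgCl k)) : P1an (CompletedAlgCl k)) = y ∧
    Set.BijOn (proj k) (diskArc a b r s) (arc x y) ∧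
    d = diskDist a b r s

/-- The interval length: the supremum of the distances of the pairs of points of type 2 or 3
on the path `[u, v]`. -/
def rho (u v : P1an k) : ℝ≥0∞ :=
  sSup {d | ∃ x ∈ arc u v, ∃ y ∈ arc u v, ∃ l : ℝ, HasLength x y l ∧ d = ENNReal.ofReal l}

open Classical in
/-- The retraction `x ∧_z y` of `z` on `[x, y]`: the point of `[x, y]` at which the path issued
from `z` first meets `[x, y]`. -/
def wedge (z x y : P1an k) : P1an k :=
  if h : ∃ w ∈ arc x y, arc z w ∩ arc x y = {w} then h.choose else z

/-! ### The Gromov compactification -/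

/-- The quantity `ρ(η, x ∧_η y)`. -/
def gromovProd (η x y : HypSpace k) : ℝ≥0∞ := rho η.1 (wedge η.1 x.1 y.1)

/-- The sequences of points of the hyperbolic space which converge at infinity. -/
def GromovSeq (η : HypSpace k) : Type _ :=
  {x : ℕ → HypSpace k //
    Tendsto (fun p : ℕ × ℕ => gromovProd η (x p.1) (x p.2)) atTop (𝓝 ⊤)}

/-- Equivalence of sequences which converge at infinity. -/
def GromovEquiv (η : HypSpace k) (x y : GromovSeq η) : Prop :=
  Tendsto (fun p : ℕ × ℕ => gromovProd η (x.1 p.1) (y.1 p.2)) atTop (𝓝 ⊤)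

/-- The Gromov boundary. -/
def GromovBoundary (η : HypSpace k) : Type _ := Quot (GromovEquiv η)

/-- The underlying set of the Gromov compactification: the disjoint union of the hyperbolic space
and its Gromov boundary. -/
inductive GromovCompactification (η : HypSpace k) : Type _
  | inner (x : HypSpace k) : GromovCompactification η
  | bdry (ξ : GromovBoundary η) : GromovCompactification η

/-- The sequence `y` represents `p`: it is constant of value `p` if `p` is in the hyperbolic
space, and it belongs to the class `p` if `p` is in the boundary. -/
def Represents {η : HypSpace k} (y : ℕ → HypSpace k) : GromovCompactification η → Prop
  | .inner z => ∀ n, y n = z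
  | .bdry ξ => ∃ y' : GromovSeq η, y'.1 = y ∧ Quot.mk _ y' = ξ

/-- The basic neighborhood `N_t(ξ)` of a boundary point `ξ`. -/
def gromovNhd {η : HypSpace k} (ξ : GromovBoundary η) (t : ℝ≥0) :
    Set (GromovCompactification η) :=
  {p | ∃ x y : ℕ → HypSpace k, Represents x (.bdry ξ : GromovCompactification η) ∧
    Represents y p ∧
    (t : ℝ≥0∞) < liminf (fun q : ℕ × ℕ => gromovProd η (x q.1) (y q.2)) atTop}

/-- The Gromov topology: a set is open if its trace on the hyperbolic space is open for `rho` and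
if it contains some `N_t(ξ)`, `t > 0`, for each of its boundary points `ξ`. -/
instance (η : HypSpace k) : TopologicalSpace (GromovCompactification η) where
  IsOpen U :=
    (∀ x : HypSpace k, .inner x ∈ U →
      ∃ ε : ℝ≥0∞, 0 < ε ∧ ∀ y : HypSpace k, rho x.1 y.1 < ε → .inner y ∈ U) ∧
    (∀ ξ : GromovBoundary η, .bdry ξ ∈ U → ∃ t : ℝ≥0, 0 < t ∧ gromovNhd ξ t ⊆ U)
  isOpen_univ := ⟨fun _ _ => ⟨1, one_pos, fun _ _ => trivial⟩,
    fun _ _ => ⟨1, one_pos, Set.subset_univ _⟩⟩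
  isOpen_inter := by
    rintro U V ⟨hU, hU'⟩ ⟨hV, hV'⟩
    refine ⟨fun x hx => ?_, fun ξ hξ => ?_⟩
    · obtain ⟨ε, h0, h1⟩ := hU x hx.1
      obtain ⟨δ, h2, h3⟩ := hV x hx.2
      exact ⟨min ε δ, lt_min h0 h2, fun y hy =>
        ⟨h1 y (hy.trans_le (min_le_left _ _)), h3 y (hy.trans_le (min_le_right _ _))⟩⟩
    · obtain ⟨s, h0, h1⟩ := hU' ξ hξ.1
      obtain ⟨t, h2, h3⟩ := hV' ξ hξ.2
      refine ⟨max s t, lt_max_of_lt_left h0, ?_⟩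
      rintro p ⟨x, y, hx, hy, hp⟩
      exact ⟨h1 ⟨x, y, hx, hy, lt_of_le_of_lt (by exact_mod_cast le_max_left s t) hp⟩,
        h3 ⟨x, y, hx, hy, lt_of_le_of_lt (by exact_mod_cast le_max_right s t) hp⟩⟩
  isOpen_sUnion := by
    intro S hS
    refine ⟨?_, ?_⟩
    · rintro x ⟨U, hU, hx⟩
      obtain ⟨ε, h0, h1⟩ := (hS U hU).1 x hx
      exact ⟨ε, h0, fun y hy => ⟨U, hU, h1 y hy⟩⟩
    · rintro ξ ⟨U, hU, hξ⟩
      obtain ⟨t, h0, h1⟩ := (hS U hU).2 ξ hξ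
      exact ⟨t, h0, h1.trans (Set.subset_sUnion_of_mem hU)⟩

end Hyperbolic

end BerkovichLine

end

noncomputable section

namespace BerkovichLine

/-! ### Points of the affine line as evaluations in a normed field -/

/-! The geometry is carried out over `k` itself, by a flow on seminorms. Let ∂ₙ be the Hasse
derivatives, so that the coefficients of P(T + a) are ∂ₙP(a). Then `flow x t` is P ↦ maxₙ |∂ₙP|_x
tⁿ. Every x is evaluation at a point τ of a normed field containing the algebraic closure
(`exists_eq_pt`), and the flow replaces τ by the disk of radius t around it, which moves x towards
∞. Two numbers describe the tree: `rad x`, the last time at which x has not moved, which vanishes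
exactly at the affine points of type 1, and J(x,y) = `joinRad x y`, the first time, not before
either radius, at which the two flow lines agree. J satisfies the ultrametric inequality.

A ball J(·,x) < t with t > rad x is open (`isOpen_joinRad_lt`) and becomes closed once `flow x t` is
added, so a path leaving it crosses that point. Hence [x,y] climbs from both ends to the join
(`arc_coe`). Its length is 2 log J(x,y) - log rad x - log rad y (`rho_coe`), and with μ =
min(J(η,x), J(η,y)) the Gromov product is 2 log μ - log rad η - log min(μ, J(x,y)) (`rho_wedge`). It
can be large only if μ is large or J(x,y) is small.

By compactness, the sets J(·,p) ≤ s form a neighborhood basis of a type 1 point p, and the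
complements of J(·,η) < M one of ∞. So the product is large when both points are near the same type
1 point (`exists_nhd_le_treeProd`), and bounded when exactly the first lies in a suitable small
neighborhood (`exists_isClosed_nhd_treeProd_le`). These two estimates give the limits, the
bijection, continuity at the boundary and the converse for sequences. Continuity inside follows from
|P|_y ≤ exp(ρ(x,y) deg P) |P|_x. -/

theorem apply_natCast_le_one {k : Type*} [NormedField k] [IsUltrametricDist k] (x : A1an k)
    (n : ℕ) : x.1 (n : k[X]) ≤ 1 := by
  have h := x.2 (n : k)
  rw [map_natCast] at h
  rw [h]
  exact IsUltrametricDist.norm_natCast_le_one k n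

/-- In the expansion of (f + g)^m the binomial coefficients have norm at most one, so |f + g|^m ≤ (m
+ 1) M^m; for large m the factor m + 1 is absorbed by (a / M)^m. -/
theorem isNonarchimedean {k : Type*} [NormedField k] [IsUltrametricDist k] (x : A1an k)
    (f g : k[X]) : x.1 (f + g) ≤ max (x.1 f) (x.1 g) := by
  set M := max (x.1 f) (x.1 g) with hM
  have hf0 : 0 ≤ x.1 f := apply_nonneg _ _
  have hg0 : 0 ≤ x.1 g := apply_nonneg _ _
  have hf : x.1 f ≤ M := le_max_left _ _
  have hg : x.1 g ≤ M := le_max_right _ _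
  rcases (hf0.trans hf).eq_or_lt with h0 | h0
  · have := map_add_le_add x.1 f g
    linarith
  refine le_of_forall_gt_imp_ge_of_dense fun a ha => ?_
  obtain ⟨m, hm⟩ : ∃ m : ℕ, ((m + 1) : ℕ) < (a / M) ^ m := by
    apply_mod_cast Real.exists_natCast_add_one_lt_pow_of_one_lt
    rwa [one_lt_div h0]
  rw [div_pow, lt_div_iff₀ (by positivity)] at hm
  have key : x.1 (f + g) ^ m ≤ (m + 1 : ℕ) * M ^ m := by
    rw [← map_pow, (Commute.all f g).add_pow]
    refine (Finset.le_sum_of_subadditive x.1 (map_zero x.1).le (map_add_le_add x.1) _ _).trans ?_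
    have : ∀ i ∈ Finset.range (m + 1), x.1 (f ^ i * g ^ (m - i) * (m.choose i : k[X])) ≤ M ^ m := by
      intro i hi
      rw [map_mul, map_mul, map_pow, map_pow]
      calc x.1 f ^ i * x.1 g ^ (m - i) * x.1 (m.choose i : k[X])
          ≤ M ^ i * M ^ (m - i) * 1 := by
            gcongr
            exact apply_natCast_le_one x _
        _ = M ^ m := by
            rw [mul_one, ← pow_add, Nat.add_sub_cancel' (Nat.lt_succ_iff.1 (Finset.mem_range.1 hi))]
    refine (Finset.sum_le_card_nsmul _ _ _ this).trans ?_
    simp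
  have hm0 : m ≠ 0 := by
    rintro rfl
    simp at hm
  exact le_of_pow_le_pow_left₀ hm0 (h0.trans ha).le (key.trans hm.le)

/-- The norm on a field attached to a real valuation. -/
abbrev normedFieldOfValuation {F : Type*} [Field F] (w : Valuation F ℝ≥0) : NormedField F where
  norm z := (w z : ℝ)
  dist y z := (w (y - z) : ℝ)
  dist_self y := by simp
  dist_comm y z := by rw [← neg_sub, Valuation.map_neg]
  dist_triangle x y z := by
    rw [← sub_add_sub_cancel x y z]
    have h : w (x - y + (y - z)) ≤ w (x - y) + w (y - z) :=
      (w.map_add _ _).trans (max_le (le_add_of_nonneg_right zero_le)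
        (le_add_of_nonneg_left zero_le))
    exact_mod_cast h
  eq_of_dist_eq_zero h := sub_eq_zero.1 (w.zero_iff.1 (by exact_mod_cast h))
  dist_eq x y := by rw [← Valuation.map_neg, neg_sub, sub_eq_neg_add]
  norm_mul x y := by simp

/-- The valuation on polynomials attached to a point of the affine line. -/
def toValuation {k : Type*} [NormedField k] [IsUltrametricDist k] (x : A1an k) :
    Valuation k[X] ℝ≥0 where
  toFun P := ⟨x.1 P, apply_nonneg _ _⟩
  map_zero' := Subtype.ext (map_zero x.1)
  map_one' := Subtype.ext (map_one x.1)
  map_mul' P Q := Subtype.ext (map_mul x.1 P Q)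
  map_add_le_max' P Q := isNonarchimedean x P Q

/-- The residue field at `x`, with the point `T`. -/
theorem exists_residueField {k : Type u} [NormedField k] [IsUltrametricDist k] (x : A1an k) :
    ∃ (F : Type u) (_ : NormedField F) (_ : NormedAlgebra k F) (τ : F),
      ∀ P : k[X], x.1 P = ‖aeval τ P‖ := by
  set v := toValuation x
  let R := k[X] ⧸ v.supp
  let v₀ : Valuation R ℝ≥0 := v.onQuot le_rfl
  -- On the quotient by its support the valuation vanishes only at zero, so it extends to the
  -- fraction field.
  have hS : nonZeroDivisors R ≤ v₀.supp.primeCompl := by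
    intro z hz h
    rw [Valuation.supp_quot_supp] at h
    exact nonZeroDivisors.ne_zero hz h
  let w : Valuation (FractionRing R) ℝ≥0 := v₀.extendToLocalization hS (FractionRing R)
  have hw : ∀ P : k[X], (w (algebraMap R (FractionRing R) (Ideal.Quotient.mk _ P)) : ℝ) = x.1 P := by
    intro P
    rw [Valuation.extendToLocalization_apply_map_apply]
    rfl
  let : NormedField (FractionRing R) := normedFieldOfValuation w
  have hC : ∀ c : k, algebraMap k (FractionRing R) c =
      algebraMap R (FractionRing R) (Ideal.Quotient.mk _ (C c)) := by
    intro c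
    rw [IsScalarTower.algebraMap_apply k R (FractionRing R)]
    rfl
  let : NormedAlgebra k (FractionRing R) :=
    { norm_smul_le := fun c z => by
        rw [Algebra.smul_def, norm_mul]
        refine le_of_eq ?_
        congr 1
        rw [hC]
        exact (hw _).trans (x.2 c) }
  refine ⟨FractionRing R, inferInstance, inferInstance,
    algebraMap R (FractionRing R) (Ideal.Quotient.mk _ X), fun P => ?_⟩
  rw [← hw P]
  change _ = ((w _ : ℝ≥0) : ℝ)
  congr 2
  have : aeval (algebraMap R (FractionRing R) (Ideal.Quotient.mk _ X)) =
    (((IsScalarTower.toAlgHom k R (FractionRing R)).comp (Ideal.Quotient.mkₐ k v.supp))) := by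
    ext
    simp only [aeval_X]
    rfl
  rw [this]
  rfl

instance (k : Type*) [Field k] : IsAlgClosed (AlgCl k) :=
  inferInstanceAs (IsAlgClosed (AlgebraicClosure k))

/-- The norm pulled back along ι is power-multiplicative and ultrametric, and the spectral norm
dominates every such algebra norm. -/
theorem norm_algHom_le {k : Type*} [NormedField k] [CompleteSpace k] [IsUltrametricDist k]
    {L : Type*} [NormedField L] [NormedAlgebra k L] (ι : AlgCl k →ₐ[k] L) (y : AlgCl k) :
    ‖ι y‖ ≤ ‖y‖ := by
  have : IsUltrametricDist L := IsUltrametricDist.of_normedAlgebra k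
  let f : AlgebraNorm k (AlgCl k) :=
    { toFun := fun y => ‖ι y‖
      map_zero' := by simp
      add_le' := fun a b => by rw [map_add]; exact norm_add_le _ _
      neg' := fun a => by simp
      mul_le' := fun a b => by rw [map_mul, norm_mul]
      eq_zero_of_map_eq_zero' := fun a h => by simpa using h
      smul' := fun c a => by rw [map_smul, norm_smul] }
  exact norm_le_spectralNorm (f := f) (fun a n _ => by change ‖ι (a ^ n)‖ = ‖ι a‖ ^ n; simp)
    (fun a b => by
      change ‖ι (a + b)‖ ≤ _
      rw [map_add]; exact IsUltrametricDist.norm_add_le_max _ _)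
    (Algebra.IsAlgebraic.isAlgebraic y)

theorem norm_algHom {k : Type*} [NormedField k] [CompleteSpace k] [IsUltrametricDist k]
    {L : Type*} [NormedField L] [NormedAlgebra k L] (ι : AlgCl k →ₐ[k] L) (y : AlgCl k) :
    ‖ι y‖ = ‖y‖ := by
  refine le_antisymm (norm_algHom_le ι y) ?_
  rcases eq_or_ne y 0 with rfl | hy
  · simp
  have h := norm_algHom_le ι y⁻¹
  rw [map_inv₀, norm_inv, norm_inv] at h
  have h1 : ι y ≠ 0 := by simpa using hy
  exact (inv_le_inv₀ (norm_pos_iff.2 h1) (norm_pos_iff.2 hy)).1 h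

/-- Each point of the affine line is given by evaluation at a point of a normed field into which
an algebraic closure of `k` embeds. -/
theorem exists_lift {k : Type u} [NormedField k] [CompleteSpace k] [IsUltrametricDist k]
    (x : A1an k) :
    ∃ (L : Type u) (_ : NormedField L) (_ : NormedAlgebra k L) (τ : L) (_ : AlgCl k →ₐ[k] L),
      ∀ P : k[X], x.1 P = ‖aeval τ P‖ := by
  obtain ⟨F, _, _, τ, hτ⟩ := exists_residueField x
  -- Completing first gives `AlgCl H` its multiplicative norm; being algebraically closed, it
  -- receives the algebraic closure of `k`.
  let H := UniformSpace.Completion F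
  have : IsUltrametricDist H := IsUltrametricDist.of_normedAlgebra k
  let : NormedAlgebra k (AlgCl H) :=
    { ((algebraMap H (AlgCl H)).comp (algebraMap k H)).toAlgebra with
      norm_smul_le := fun c z => by
        change ‖algebraMap H (AlgCl H) (algebraMap k H c) * z‖ ≤ _
        rw [norm_mul, norm_algebraMap', norm_algebraMap'] }
  have : IsScalarTower k H (AlgCl H) := IsScalarTower.of_algebraMap_eq fun _ => rfl
  refine ⟨AlgCl H, inferInstance, inferInstance, algebraMap H (AlgCl H) (τ : H),
    IsAlgClosed.lift, fun P => ?_⟩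
  rw [aeval_algebraMap_apply, norm_algebraMap', hτ P]
  have : aeval (τ : H) P = ((aeval τ P : F) : H) := by
    exact (hom_eval₂ P (algebraMap k F) UniformSpace.Completion.coeRingHom τ).symm
  rw [this, UniformSpace.Completion.norm_coe]

/-! ### Disk points over `k` -/

theorem A1an.ext {k : Type*} [NormedField k] {x y : A1an k} (h : ∀ P, x.1 P = y.1 P) : x = y :=
  Subtype.ext (DFunLike.ext _ _ h)

/-- The image in the affine line over `k` of the disk point `η_{a,r}`. -/
def pt (k : Type*) {L : Type*} [NormedField k] [NormedField L] [NormedAlgebra k L]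
    [IsUltrametricDist L] (a : L) (r : ℝ≥0) : A1an k :=
  restrict k (diskPoint a r)

section Points

variable {k L : Type*} [NormedField k] [NormedField L] [NormedAlgebra k L] [IsUltrametricDist L]

theorem norm_coeff_mul_le_diskPoint (a : L) (r : ℝ≥0) (Q : L[X]) (n : ℕ) :
    ‖(taylor a Q).coeff n‖ * (r : ℝ) ^ n ≤ (diskPoint a r).1 Q :=
  le_gaussNorm (NormedField.toAbsoluteValue L) (taylor a Q) r.2 n

theorem exists_diskPoint_eq (a : L) (r : ℝ≥0) (Q : L[X]) :
    ∃ n, (diskPoint a r).1 Q = ‖(taylor a Q).coeff n‖ * (r : ℝ) ^ n :=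
  exists_eq_gaussNorm (NormedField.toAbsoluteValue L) r (taylor a Q)

omit [IsUltrametricDist L] in
theorem hasseDeriv_map (P : k[X]) (n : ℕ) :
    hasseDeriv n (P.map (algebraMap k L)) = (hasseDeriv n P).map (algebraMap k L) := by
  ext i
  simp [hasseDeriv_coeff]

omit [IsUltrametricDist L] in
-- Hasse derivatives stay in `k[X]`, so the restriction of η_{a,r} to `k[X]` depends only on r and
-- the seminorm P ↦ |P(a)|. This is what makes a flow over `k` possible.
theorem taylor_map_coeff (a : L) (P : k[X]) (n : ℕ) :
    (taylor a (P.map (algebraMap k L))).coeff n = aeval a (hasseDeriv n P) := by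
  rw [taylor_coeff, hasseDeriv_map, eval_map_algebraMap]

theorem norm_hasseDeriv_mul_le_pt (a : L) (r : ℝ≥0) (P : k[X]) (n : ℕ) :
    ‖aeval a (hasseDeriv n P)‖ * (r : ℝ) ^ n ≤ (pt k a r).1 P := by
  rw [← taylor_map_coeff]
  exact norm_coeff_mul_le_diskPoint a r _ n

theorem exists_pt_eq (a : L) (r : ℝ≥0) (P : k[X]) :
    ∃ n ≤ P.natDegree, (pt k a r).1 P = ‖aeval a (hasseDeriv n P)‖ * (r : ℝ) ^ n := by
  obtain ⟨n, hn⟩ := exists_diskPoint_eq a r (P.map (algebraMap k L))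
  rw [taylor_map_coeff] at hn
  change (pt k a r).1 P = _ at hn
  by_cases h : n ≤ P.natDegree
  · exact ⟨n, h, hn⟩
  · rw [hasseDeriv_eq_zero_of_lt_natDegree _ _ (not_le.1 h), map_zero, norm_zero, zero_mul] at hn
    refine ⟨0, zero_le, le_antisymm (hn.trans_le (by positivity)) ?_⟩
    exact norm_hasseDeriv_mul_le_pt a r P 0

theorem pt_zero_apply (a : L) (P : k[X]) : (pt k a 0).1 P = ‖aeval a P‖ := by
  refine le_antisymm ?_ ?_
  · obtain ⟨n, -, hn⟩ := exists_pt_eq a 0 P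
    rw [hn]
    rcases n with _ | n
    · simp
    · simp
  · simpa using norm_hasseDeriv_mul_le_pt a 0 P 0

theorem norm_aeval_le_pt (a : L) (r : ℝ≥0) (P : k[X]) : ‖aeval a P‖ ≤ (pt k a r).1 P := by
  simpa using norm_hasseDeriv_mul_le_pt a r P 0

/-- A composite ∂ⱼ∂ₙ is ∂ⱼ₊ₙ times a binomial coefficient, of norm at most one. Allowing two radii r
and t below s serves the composition of flows. -/
theorem pt_hasseDeriv_mul_le (a : L) {r s t : ℝ≥0} (hr : r ≤ s) (ht : t ≤ s) (P : k[X]) (n : ℕ) :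
    (pt k a r).1 (hasseDeriv n P) * (t : ℝ) ^ n ≤ (pt k a s).1 P := by
  obtain ⟨j, -, hj⟩ := exists_pt_eq a r (hasseDeriv n P)
  have hc : hasseDeriv j (hasseDeriv n P) = ((j + n).choose j : k[X]) * hasseDeriv (j + n) P := by
    have := LinearMap.congr_fun (hasseDeriv_comp (R := k) j n) P
    simpa [nsmul_eq_mul] using this
  have hle : ‖aeval a (hasseDeriv j (hasseDeriv n P))‖ ≤ ‖aeval a (hasseDeriv (j + n) P)‖ := by
    rw [hc, map_mul, norm_mul, map_natCast]
    exact mul_le_of_le_one_left (norm_nonneg _) (IsUltrametricDist.norm_natCast_le_one L _)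
  have hr' : (r : ℝ) ≤ s := hr
  have ht' : (t : ℝ) ≤ s := ht
  calc _ ≤ ‖aeval a (hasseDeriv (j + n) P)‖ * (s : ℝ) ^ j * (s : ℝ) ^ n := by rw [hj]; gcongr
    _ = ‖aeval a (hasseDeriv (j + n) P)‖ * (s : ℝ) ^ (j + n) := by ring
    _ ≤ _ := norm_hasseDeriv_mul_le_pt a s P (j + n)

theorem norm_aeval_le_pt_of_norm_sub_le {a b : L} {r : ℝ≥0} (h : ‖a - b‖ ≤ r) (Q : k[X]) :
    ‖aeval a Q‖ ≤ (pt k b r).1 Q := by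
  have h1 : aeval a Q = (taylor b (Q.map (algebraMap k L))).eval (a - b) := by
    rw [taylor_eval, sub_add_cancel, eval_map_algebraMap]
  rw [h1, eval_eq_sum_range]
  refine IsUltrametricDist.norm_sum_le_of_forall_le_of_nonneg (apply_nonneg _ _) fun i _ => ?_
  rw [norm_mul, norm_pow, taylor_map_coeff]
  refine le_trans ?_ (norm_hasseDeriv_mul_le_pt b r Q i)
  gcongr

theorem pt_eq_of_norm_sub_le {a b : L} {r : ℝ≥0} (h : ‖a - b‖ ≤ r) : pt k a r = pt k b r := by
  have key : ∀ {a b : L}, ‖a - b‖ ≤ r → ∀ P, (pt k a r).1 P ≤ (pt k b r).1 P := by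
    intro a b h P
    obtain ⟨n, -, hn⟩ := exists_pt_eq a r P
    rw [hn]
    refine le_trans ?_ (pt_hasseDeriv_mul_le b le_rfl le_rfl P n)
    gcongr
    exact norm_aeval_le_pt_of_norm_sub_le h _
  exact A1an.ext fun P => le_antisymm (key h P) (key (by rwa [norm_sub_rev]) P)

theorem diskPoint_X_sub_C (a b : L) (r : ℝ≥0) :
    (diskPoint a r).1 (X - C b) = max ‖a - b‖ r := by
  have ht : taylor a (X - C b) = X + C (a - b) := by
    rw [map_sub, taylor_X, taylor_C, C_sub]
    ring
  refine le_antisymm ?_ (max_le ?_ ?_)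
  · obtain ⟨n, hn⟩ := exists_diskPoint_eq a r (X - C b)
    rw [hn, ht]
    rcases n with _ | _ | n
    · simp
    · simp
    · simp [coeff_X]
  · have h := norm_coeff_mul_le_diskPoint a r (X - C b) 0
    rw [ht] at h
    simpa using h
  · have h := norm_coeff_mul_le_diskPoint a r (X - C b) 1
    rw [ht] at h
    simpa using h

theorem leadingCoeff_mul_le_pt (a : L) (r : ℝ≥0) (P : k[X]) :
    ‖P.leadingCoeff‖ * (r : ℝ) ^ P.natDegree ≤ (pt k a r).1 P := by
  simpa [hasseDeriv_natDegree_eq_C] using norm_hasseDeriv_mul_le_pt a r P P.natDegree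

theorem pt_algHom {M : Type*} [NormedField M] [NormedAlgebra k M] [IsUltrametricDist M]
    (f : L →ₐ[k] M) (hf : ∀ z, ‖f z‖ = ‖z‖) (a : L) (r : ℝ≥0) : pt k (f a) r = pt k a r := by
  refine A1an.ext fun P => le_antisymm ?_ ?_
  · obtain ⟨n, -, hn⟩ := exists_pt_eq (f a) r P
    rw [hn, aeval_algHom_apply, hf]
    exact norm_hasseDeriv_mul_le_pt a r P n
  · obtain ⟨n, -, hn⟩ := exists_pt_eq a r P
    rw [hn, ← hf, ← aeval_algHom_apply]
    exact norm_hasseDeriv_mul_le_pt (f a) r P n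

/-- If the value of `P` differs at two radii around `a`, there is a root of `P` at distance less
than the largest radius. -/
theorem exists_root_of_pt_lt {E : Type*} [Field E] [Algebra k E] [IsAlgClosed E] (ι : E →ₐ[k] L)
    {a : L} {r s : ℝ≥0} (hrs : r ≤ s) {P : k[X]} (h : (pt k a r).1 P < (pt k a s).1 P) :
    ∃ b : E, aeval b P = 0 ∧ ‖a - ι b‖ < s := by
  by_contra! hc
  refine h.ne ?_
  -- At radius t a factor X - ι b takes the value max(|a - ι b|, t), which is constant for t ≤ s
  -- when |a - ι b| ≥ s.
  have hsplit : P.map (algebraMap k L) =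
      C (algebraMap k L P.leadingCoeff) * ((P.map (algebraMap k E)).roots.map
        fun b => X - C (ι b)).prod := by
    have h1 := (IsAlgClosed.splits (P.map (algebraMap k E))).eq_prod_roots
    have h2 := congr_arg (Polynomial.map (ι : E →+* L)) h1
    rw [Polynomial.map_map, AlgHom.comp_algebraMap, Polynomial.map_mul, map_C,
      Polynomial.map_multiset_prod, Multiset.map_map, leadingCoeff_map] at h2
    simpa using h2
  have hval : ∀ t : ℝ≥0, (pt k a t).1 P = ‖P.leadingCoeff‖ *
      ((P.map (algebraMap k E)).roots.map fun b => max ‖a - ι b‖ (t : ℝ)).prod := by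
    intro t
    change (diskPoint a t).1 (P.map (algebraMap k L)) = _
    rw [hsplit, map_mul, (diskPoint a t).2, norm_algebraMap', map_multiset_prod, Multiset.map_map]
    simp only [Function.comp_def, diskPoint_X_sub_C]
  rw [hval, hval]
  congr 2
  refine Multiset.map_congr rfl fun b hb => ?_
  have hb' : aeval b P = 0 := by
    rw [← eval_map_algebraMap]
    exact isRoot_of_mem_roots hb
  have hs := hc b hb'
  rw [max_eq_left hs, max_eq_left (le_trans (by exact_mod_cast hrs) hs)]

end Points

/-! ### Conjugate centers and centers in the completion -/

section Conjugates

variable {k : Type*} [NormedField k] [CompleteSpace k] [IsUltrametricDist k]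

instance : IsUltrametricDist (AlgCl k) := IsUltrametricDist.of_normedAlgebra k

theorem pt_eq_of_isConjRoot {a b : AlgCl k} (h : IsConjRoot k a b) (r : ℝ≥0) :
    pt k a r = pt k b r := by
  have : Normal k (AlgCl k) := inferInstanceAs (Normal k (AlgebraicClosure k))
  obtain ⟨σ, rfl⟩ := isConjRoot_iff_exists_algEquiv.1 h
  exact (pt_algHom (σ : AlgCl k →ₐ[k] AlgCl k)
    (fun z => (spectralNorm_eq_of_equiv (K := k) σ z).symm) b r)

theorem pt_eq_of_aeval_minpoly {a b : AlgCl k} (h : aeval b (minpoly k a) = 0) (r : ℝ≥0) :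
    pt k b r = pt k a r :=
  (pt_eq_of_isConjRoot (isConjRoot_of_aeval_eq_zero
    (Algebra.IsAlgebraic.isAlgebraic a).isIntegral h) r).symm

theorem pt_coe (a : AlgCl k) (r : ℝ≥0) : pt k (a : CompletedAlgCl k) r = pt k a r :=
  pt_algHom { UniformSpace.Completion.coeRingHom with commutes' := fun _ => rfl }
    (fun z => UniformSpace.Completion.norm_coe z) a r

end Conjugates

/-! ### The flow towards infinity and the tree structure of the affine line -/

section Flow

variable {k : Type*} [NormedField k] [CompleteSpace k] [IsUltrametricDist k]

theorem exists_eq_pt {k : Type u} [NormedField k] [CompleteSpace k] [IsUltrametricDist k]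
    (x : A1an k) :
    ∃ (L : Type u) (_ : NormedField L) (_ : NormedAlgebra k L) (_ : IsUltrametricDist L) (τ : L)
      (_ : AlgCl k →ₐ[k] L), x = pt k τ 0 := by
  obtain ⟨L, _, _, τ, ι, h⟩ := exists_lift x
  have : IsUltrametricDist L := IsUltrametricDist.of_normedAlgebra k
  exact ⟨L, inferInstance, inferInstance, inferInstance, τ, ι,
    A1an.ext fun P => by rw [h, pt_zero_apply]⟩

theorem exists_flow (x : A1an k) (t : ℝ≥0) :
    ∃ y : A1an k, (∀ P n, x.1 (hasseDeriv n P) * (t : ℝ) ^ n ≤ y.1 P) ∧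
      ∀ P, ∃ n ≤ P.natDegree, y.1 P = x.1 (hasseDeriv n P) * (t : ℝ) ^ n := by
  obtain ⟨L, _, _, _, τ, -, rfl⟩ := exists_eq_pt x
  refine ⟨pt k τ t, fun P n => ?_, fun P => ?_⟩
  · rw [pt_zero_apply]
    exact norm_hasseDeriv_mul_le_pt τ t P n
  · simpa only [pt_zero_apply] using exists_pt_eq τ t P

/-- The point `P ↦ max |∂ₙ P|_x tⁿ`, where `∂ₙ` are the Hasse derivatives. For points over the
completed algebraic closure this is the point on the path from `x` to `∞` at radius `t`, or `x`
itself if the radius of `x` is at least `t`. -/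
def flow (x : A1an k) (t : ℝ≥0) : A1an k := (exists_flow x t).choose

theorem hasseDeriv_mul_le_flow (x : A1an k) (t : ℝ≥0) (P : k[X]) (n : ℕ) :
    x.1 (hasseDeriv n P) * (t : ℝ) ^ n ≤ (flow x t).1 P :=
  (exists_flow x t).choose_spec.1 P n

theorem exists_flow_eq (x : A1an k) (t : ℝ≥0) (P : k[X]) :
    ∃ n ≤ P.natDegree, (flow x t).1 P = x.1 (hasseDeriv n P) * (t : ℝ) ^ n :=
  (exists_flow x t).choose_spec.2 P

/-- Every point is some `pt k τ 0`, so identities of the flow reduce to identities between maxima of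
radii. -/
theorem flow_pt {L : Type*} [NormedField L] [NormedAlgebra k L] [IsUltrametricDist L]
    (a : L) (r t : ℝ≥0) : flow (pt k a r) t = pt k a (max r t) := by
  refine A1an.ext fun P => le_antisymm ?_ ?_
  · obtain ⟨n, -, hn⟩ := exists_flow_eq (pt k a r) t P
    rw [hn]
    exact pt_hasseDeriv_mul_le a (le_max_left _ _) (le_max_right _ _) P n
  · rcases le_total r t with h | h
    · rw [max_eq_right h]
      obtain ⟨n, -, hn⟩ := exists_pt_eq a t P
      rw [hn]
      refine le_trans ?_ (hasseDeriv_mul_le_flow (pt k a r) t P n)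
      gcongr
      exact norm_aeval_le_pt a r _
    · rw [max_eq_left h]
      simpa using hasseDeriv_mul_le_flow (pt k a r) t P 0

theorem flow_flow (x : A1an k) (s t : ℝ≥0) : flow (flow x s) t = flow x (max s t) := by
  obtain ⟨L, _, _, _, τ, -, rfl⟩ := exists_eq_pt x
  simp [flow_pt]

theorem flow_zero (x : A1an k) : flow x 0 = x := by
  obtain ⟨L, _, _, _, τ, -, rfl⟩ := exists_eq_pt x
  simp [flow_pt]

theorem le_flow (x : A1an k) (t : ℝ≥0) (P : k[X]) : x.1 P ≤ (flow x t).1 P := by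
  simpa using hasseDeriv_mul_le_flow x t P 0

theorem flow_mono (x : A1an k) {s t : ℝ≥0} (h : s ≤ t) (P : k[X]) :
    (flow x s).1 P ≤ (flow x t).1 P := by
  have := le_flow (flow x s) t P
  rwa [flow_flow, max_eq_right h] at this

/-- Once |P| has grown, its maximum is attained by a term with n > 0 and nonzero coefficient, and
such a term increases strictly with the radius. -/
theorem flow_lt_flow {x : A1an k} {s t : ℝ≥0} {P : k[X]} (h : x.1 P < (flow x s).1 P)
    (hst : s < t) : (flow x s).1 P < (flow x t).1 P := by
  obtain ⟨n, -, hn⟩ := exists_flow_eq x s P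
  have hn0 : n ≠ 0 := by
    rintro rfl
    simp at hn
    exact h.ne' hn
  have hpos : 0 < x.1 (hasseDeriv n P) := by
    refine (apply_nonneg x.1 _).lt_of_ne fun h0 => ?_
    rw [← h0, zero_mul] at hn
    exact (h.trans_eq hn).not_ge (apply_nonneg _ _)
  refine lt_of_lt_of_le ?_ (hasseDeriv_mul_le_flow x t P n)
  rw [hn]
  have : (s : ℝ) < t := hst
  gcongr

theorem le_flow_X (x : A1an k) (t : ℝ≥0) : (t : ℝ) ≤ (flow x t).1 X := by
  simpa [hasseDeriv_one'] using hasseDeriv_mul_le_flow x t (X : k[X]) 1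

/-- A point which strictly increases under the flow is moved to a disk point. -/
theorem exists_flow_eq_pt {x : A1an k} {t : ℝ≥0} {P : k[X]} (h : x.1 P < (flow x t).1 P) :
    ∃ b : AlgCl k, aeval b P = 0 ∧ flow x t = pt k b t := by
  obtain ⟨L, _, _, _, τ, ι, rfl⟩ := exists_eq_pt x
  rw [flow_pt, max_eq_right zero_le] at h ⊢
  obtain ⟨b, hb, hbt⟩ := exists_root_of_pt_lt ι zero_le h
  refine ⟨b, hb, ?_⟩
  rw [pt_eq_of_norm_sub_le hbt.le, pt_algHom ι (norm_algHom ι)]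

theorem pt_lt_pt {b : AlgCl k} {P : k[X]} (hP : P ≠ 0) (hb : aeval b P = 0) {s t : ℝ≥0}
    (h : s < t) : (pt k b s).1 P < (pt k b t).1 P := by
  have h0 : (pt k b 0).1 P = 0 := by rw [pt_zero_apply, hb, norm_zero]
  have hpos : ∀ r : ℝ≥0, 0 < r → 0 < (pt k b r).1 P := fun r hr =>
    lt_of_lt_of_le (by have := norm_pos_iff.2 (leadingCoeff_ne_zero.2 hP); positivity)
      (leadingCoeff_mul_le_pt b r P)
  rcases eq_or_ne s 0 with rfl | hs
  · rw [h0]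
    exact hpos t h
  · have key := flow_lt_flow (x := pt k b 0) (s := s) (t := t) (P := P)
    simp only [flow_pt, max_eq_right (zero_le : (0 : ℝ≥0) ≤ _)] at key
    exact key (h0.trans_lt (hpos s (pos_iff_ne_zero.2 hs))) h

/-- From radius |τ| on, the disk around τ contains 0, so all flow lines end up along the disks
around 0. -/
theorem exists_flow_eq_flow (x y : A1an k) : ∃ t₀, ∀ t, t₀ ≤ t → flow x t = flow y t := by
  have key : ∀ x : A1an k, ∃ t₀ : ℝ≥0, ∀ t, t₀ ≤ t → flow x t = pt k (0 : k) t := by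
    intro x
    obtain ⟨L, _, _, _, τ, ι, rfl⟩ := exists_eq_pt x
    refine ⟨‖τ‖₊, fun t ht => ?_⟩
    rw [flow_pt, max_eq_right zero_le, ← pt_algHom (Algebra.ofId k L)
      (fun z => norm_algebraMap' L z)]
    refine pt_eq_of_norm_sub_le ?_
    rw [map_zero, sub_zero]
    exact_mod_cast ht
  obtain ⟨s, hs⟩ := key x
  obtain ⟨t, ht⟩ := key y
  exact ⟨max s t, fun u hu => (hs u ((le_max_left _ _).trans hu)).trans
    (ht u ((le_max_right _ _).trans hu)).symm⟩

/-! ### Topology of the affine line -/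

omit [CompleteSpace k] [IsUltrametricDist k] in
theorem continuous_eval (P : k[X]) : Continuous fun x : A1an k => x.1 P :=
  (continuous_apply P).comp continuous_induced_dom

omit [CompleteSpace k] [IsUltrametricDist k] in
theorem continuous_of_eval {Y : Type*} [TopologicalSpace Y] {f : Y → A1an k}
    (h : ∀ P, Continuous fun y => (f y).1 P) : Continuous f :=
  continuous_induced_rng.2 (continuous_pi h)

instance : T2Space (A1an k) :=
  T2Space.of_injective_continuous (f := fun (x : A1an k) (P : k[X]) => x.1 P)
    (fun _ _ h => A1an.ext (congr_fun h)) continuous_induced_dom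

theorem continuous_flow : Continuous fun p : A1an k × ℝ≥0 => flow p.1 p.2 := by
  refine continuous_of_eval fun P => ?_
  have : (fun p : A1an k × ℝ≥0 => (flow p.1 p.2).1 P) = fun p =>
      (Finset.range (P.natDegree + 1)).sup' ⟨0, by simp⟩
        fun n => p.1.1 (hasseDeriv n P) * (p.2 : ℝ) ^ n := by
    funext p
    refine le_antisymm ?_ (Finset.sup'_le _ _ fun n _ => hasseDeriv_mul_le_flow _ _ _ _)
    obtain ⟨n, hn, h⟩ := exists_flow_eq p.1 p.2 P
    rw [h]
    exact Finset.le_sup' (fun n => p.1.1 (hasseDeriv n P) * (p.2 : ℝ) ^ n)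
      (Finset.mem_range.2 (Nat.lt_succ_of_le hn))
  rw [this]
  refine Continuous.finset_sup'_apply _ fun n _ => ?_
  exact ((continuous_eval _).comp continuous_fst).mul
    ((NNReal.continuous_coe.comp continuous_snd).pow n)

theorem continuous_flow_right (x : A1an k) : Continuous (flow x) :=
  continuous_flow.comp (Continuous.prodMk_right x)

theorem continuous_flow_left (t : ℝ≥0) : Continuous fun x : A1an k => flow x t :=
  continuous_flow.comp (Continuous.prodMk_left t)

/-! ### Radii -/

theorem bddAbove_flow_eq_self (x : A1an k) : BddAbove {t | flow x t = x} := by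
  refine ⟨⟨x.1 X, apply_nonneg _ _⟩, fun t ht => ?_⟩
  have := le_flow_X x t
  rw [ht] at this
  exact this

/-- The radius of a point of the affine line. -/
def rad (x : A1an k) : ℝ≥0 := sSup {t | flow x t = x}

theorem flow_rad (x : A1an k) : flow x (rad x) = x := by
  have hc : IsClosed {t | flow x t = x} := isClosed_eq (continuous_flow_right x) continuous_const
  exact hc.csSup_mem ⟨0, flow_zero x⟩ (bddAbove_flow_eq_self x)

theorem flow_eq_self_iff {x : A1an k} {t : ℝ≥0} : flow x t = x ↔ t ≤ rad x := by
  refine ⟨fun h => le_csSup (bddAbove_flow_eq_self x) h, fun h => ?_⟩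
  have h1 := flow_flow x (rad x) t
  rwa [flow_rad, max_eq_left h, flow_rad] at h1

/-- Past the radius of x some polynomial has begun to grow, and by `flow_lt_flow` it grows strictly
from then on. -/
theorem flow_injOn {x : A1an k} {s t : ℝ≥0} (hst : s < t) (h : flow x s = flow x t) :
    t ≤ rad x := by
  by_contra! hr
  obtain ⟨u, hu, hut⟩ := exists_between (max_lt hst hr)
  have hne : flow x u ≠ x := fun h => ((le_max_right _ _).trans_lt hu).not_ge (flow_eq_self_iff.1 h)
  obtain ⟨P, hP⟩ : ∃ P, x.1 P < (flow x u).1 P := by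
    by_contra! hc
    exact hne (A1an.ext fun P => le_antisymm (hc P) (le_flow x u P))
  have h1 := flow_lt_flow hP hut
  rw [← h] at h1
  exact h1.not_ge (flow_mono x ((le_max_left _ _).trans hu.le) P)

theorem rad_flow (x : A1an k) (t : ℝ≥0) : rad (flow x t) = max t (rad x) := by
  refine eq_of_forall_le_iff fun s => ?_
  rw [← flow_eq_self_iff, flow_flow, le_max_iff]
  constructor
  · intro h
    rcases le_or_gt s t with hs | hs
    · exact Or.inl hs
    · rw [max_eq_right hs.le] at h
      exact Or.inr (flow_injOn hs h.symm)
  · rintro (h | h)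
    · rw [max_eq_left h]
    · rcases le_total s t with hs | hs
      · rw [max_eq_left hs]
      · rw [max_eq_right hs, flow_eq_self_iff.2 h, flow_eq_self_iff.2 (hs.trans h)]

theorem flow_eq_of_le_rad {x : A1an k} {t : ℝ≥0} (h : t ≤ rad x) : flow x t = x :=
  flow_eq_self_iff.2 h

/-- A point moved by the flow is moved to a disk point. -/
theorem exists_flow_eq_pt_of_rad_lt {x : A1an k} {t : ℝ≥0} (h : rad x < t) :
    ∃ b : AlgCl k, flow x t = pt k b t := by
  have hne : flow x t ≠ x := fun h' => h.not_ge (flow_eq_self_iff.1 h')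
  obtain ⟨P, hP⟩ : ∃ P, x.1 P < (flow x t).1 P := by
    by_contra! hc
    exact hne (A1an.ext fun P => le_antisymm (hc P) (le_flow x t P))
  obtain ⟨b, -, hb⟩ := exists_flow_eq_pt hP
  exact ⟨b, hb⟩

/-! ### Joins -/

/-- The radius of the join of `x` and `y`. -/
def joinRad (x y : A1an k) : ℝ≥0 := sInf {t | rad x ≤ t ∧ rad y ≤ t ∧ flow x t = flow y t}

/-- The admissible times form a closed set by continuity of the flow, stable under increase by
`flow_flow`, and nonempty because all flow lines merge. So the infimum is attained. -/
theorem joinRad_le_iff {x y : A1an k} {t : ℝ≥0} :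
    joinRad x y ≤ t ↔ rad x ≤ t ∧ rad y ≤ t ∧ flow x t = flow y t := by
  have hc : IsClosed {t | rad x ≤ t ∧ rad y ≤ t ∧ flow x t = flow y t} :=
    isClosed_Ici.inter (isClosed_Ici.inter
      (isClosed_eq (continuous_flow_right x) (continuous_flow_right y)))
  refine ⟨fun h => ?_, fun h => csInf_le (OrderBot.bddBelow _) h⟩
  have hne : {t | rad x ≤ t ∧ rad y ≤ t ∧ flow x t = flow y t}.Nonempty := by
    obtain ⟨t₀, h0⟩ := exists_flow_eq_flow x y
    exact ⟨max (max (rad x) (rad y)) t₀, (le_max_left _ _).trans (le_max_left _ _),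
      (le_max_right _ _).trans (le_max_left _ _), h0 _ (le_max_right _ _)⟩
  obtain ⟨h1, h2, h3⟩ := hc.csInf_mem hne (OrderBot.bddBelow _)
  refine ⟨h1.trans h, h2.trans h, ?_⟩
  have h4 := flow_flow x (joinRad x y) t
  have h5 := flow_flow y (joinRad x y) t
  rw [max_eq_right h] at h4 h5
  rw [← h4, ← h5]
  exact congr_arg (flow · t) h3

theorem rad_le_joinRad (x y : A1an k) : rad x ≤ joinRad x y := (joinRad_le_iff.1 le_rfl).1

theorem rad_le_joinRad' (x y : A1an k) : rad y ≤ joinRad x y := (joinRad_le_iff.1 le_rfl).2.1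

theorem flow_joinRad (x y : A1an k) : flow x (joinRad x y) = flow y (joinRad x y) :=
  (joinRad_le_iff.1 le_rfl).2.2

theorem joinRad_comm (x y : A1an k) : joinRad x y = joinRad y x := by
  refine eq_of_forall_ge_iff fun t => ?_
  rw [joinRad_le_iff, joinRad_le_iff]
  exact ⟨fun ⟨a, b, c⟩ => ⟨b, a, c.symm⟩, fun ⟨a, b, c⟩ => ⟨b, a, c.symm⟩⟩

theorem joinRad_self (x : A1an k) : joinRad x x = rad x := by
  refine eq_of_forall_ge_iff fun t => ?_
  rw [joinRad_le_iff]
  exact ⟨fun h => h.1, fun h => ⟨h, h, rfl⟩⟩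

theorem joinRad_triangle (x y z : A1an k) : joinRad x z ≤ max (joinRad x y) (joinRad y z) := by
  obtain ⟨h1, -, h3⟩ := joinRad_le_iff.1 (le_max_left (joinRad x y) (joinRad y z))
  obtain ⟨-, h5, h6⟩ := joinRad_le_iff.1 (le_max_right (joinRad x y) (joinRad y z))
  exact joinRad_le_iff.2 ⟨h1, h5, h3.trans h6⟩

theorem joinRad_flow_left (x y : A1an k) (s : ℝ≥0) :
    joinRad (flow x s) y = max s (joinRad x y) := by
  refine eq_of_forall_ge_iff fun t => ?_
  rw [joinRad_le_iff, rad_flow, max_le_iff, max_le_iff, joinRad_le_iff, flow_flow]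
  constructor
  · rintro ⟨⟨h1, h2⟩, h3, h4⟩
    rw [max_eq_right h1] at h4
    exact ⟨h1, h2, h3, h4⟩
  · rintro ⟨h1, h2, h3, h4⟩
    rw [max_eq_right h1]
    exact ⟨⟨h1, h2⟩, h3, h4⟩

theorem joinRad_flow_right (x y : A1an k) (s : ℝ≥0) :
    joinRad x (flow y s) = max s (joinRad x y) := by
  rw [joinRad_comm, joinRad_flow_left, joinRad_comm]

theorem eq_of_joinRad_le {x y : A1an k} (hx : joinRad x y ≤ rad x) (hy : joinRad x y ≤ rad y) :
    x = y := by
  have h := flow_joinRad x y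
  rwa [flow_eq_of_le_rad hx, flow_eq_of_le_rad hy] at h

/-- For distinct points the conditions on radii are automatic: before the radius of x, comparing the
radii of the flowed points shows that y has not moved either, whence x = y. -/
theorem joinRad_le_of_flow_eq {x y : A1an k} (hne : x ≠ y) {t : ℝ≥0} (h : flow x t = flow y t) :
    joinRad x y ≤ t := by
  have hr := congr_arg rad h
  rw [rad_flow, rad_flow] at hr
  have h1 : rad x ≤ t := by
    by_contra! hc
    rw [max_eq_right hc.le] at hr
    have hy : t ≤ rad y := by
      by_contra! hc'
      rw [max_eq_left hc'.le] at hr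
      exact hc.ne' hr
    exact hne (by rwa [flow_eq_of_le_rad hc.le, flow_eq_of_le_rad hy] at h)
  rw [max_eq_left h1] at hr
  exact joinRad_le_iff.2 ⟨h1, hr ▸ le_max_right _ _, h⟩

theorem joinRad_eq_of_lt {x y z : A1an k} (h : joinRad x y < joinRad y z) :
    joinRad x z = joinRad y z := by
  refine le_antisymm ((joinRad_triangle x y z).trans (max_le h.le le_rfl)) ?_
  have h1 := joinRad_triangle y x z
  rw [joinRad_comm y x] at h1
  rcases le_max_iff.1 h1 with h2 | h2
  · exact absurd h2 h.not_ge
  · exact h2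

end Flow

/-! ### Radii of disk points, and points of type 1 -/

section TypeOne

variable {k : Type*} [NormedField k] [CompleteSpace k] [IsUltrametricDist k]

theorem pt_ne_pt (b : AlgCl k) {s t : ℝ≥0} (h : s < t) : pt k b s ≠ pt k b t := fun he =>
  (pt_lt_pt (minpoly.ne_zero (Algebra.IsAlgebraic.isAlgebraic b).isIntegral) (minpoly.aeval k b)
    h).ne (by rw [he])

theorem exists_norm_sub_coe_lt (a : CompletedAlgCl k) {t : ℝ≥0} (ht : 0 < t) :
    ∃ b : AlgCl k, ‖a - b‖ < t := by
  obtain ⟨b, hb⟩ := Metric.mem_closure_range_iff.1 (UniformSpace.Completion.denseRange_coe a) t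
    (NNReal.coe_pos.2 ht)
  exact ⟨b, by rwa [← dist_eq_norm]⟩

/-- Disk points of positive radius have algebraic centers. -/
theorem exists_pt_eq_pt_algCl (a : CompletedAlgCl k) {t : ℝ≥0} (ht : 0 < t) :
    ∃ b : AlgCl k, ‖a - b‖ < t ∧ ∀ s, t ≤ s → pt k a s = pt k b s := by
  obtain ⟨b, hb⟩ := exists_norm_sub_coe_lt a ht
  refine ⟨b, hb, fun s hs => ?_⟩
  rw [← pt_coe b]
  exact pt_eq_of_norm_sub_le (hb.le.trans (by exact_mod_cast hs))

/-- On an interval of positive radii the center may be replaced by an algebraic b, and the minimal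
polynomial of b grows strictly on disks around b. So the flow cannot stall above r. -/
theorem rad_pt (a : CompletedAlgCl k) (r : ℝ≥0) : rad (pt k a r) = r := by
  refine le_antisymm ?_ (flow_eq_self_iff.1 (by rw [flow_pt, max_self]))
  by_contra! h
  obtain ⟨t, hrt, ht⟩ := exists_between h
  obtain ⟨b, -, hb⟩ := exists_pt_eq_pt_algCl a (bot_lt_of_lt hrt : 0 < t)
  have h1 : pt k a t = pt k a r := by
    have := flow_eq_of_le_rad ht.le
    rwa [flow_pt, max_eq_right hrt.le] at this
  have h2 : pt k a (rad (pt k a r)) = pt k a r := by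
    have := flow_rad (pt k a r)
    rwa [flow_pt, max_eq_right h.le] at this
  refine pt_ne_pt b ht ?_
  rw [← hb t le_rfl, ← hb _ ht.le, h1, h2]

theorem rad_pt_algCl (b : AlgCl k) (r : ℝ≥0) : rad (pt k b r) = r := by
  rw [← pt_coe, rad_pt]

/-- When every t > 0 moves the point, `exists_root_of_pt_lt` puts an algebraic element within t of
τ. As ι is isometric, these approximations form a Cauchy sequence, whose limit in the completion is
the center sought. -/
theorem exists_eq_pt_of_rad_eq_zero {x : A1an k} (hx : rad x = 0) :
    ∃ a : CompletedAlgCl k, x = pt k a 0 := by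
  obtain ⟨L, _, _, _, τ, ι, rfl⟩ := exists_eq_pt x
  have key : ∀ n : ℕ, ∃ b : AlgCl k, ‖τ - ι b‖ < 1 / ((n : ℝ) + 1) := by
    intro n
    set t : ℝ≥0 := ⟨1 / ((n : ℝ) + 1), by positivity⟩ with ht
    have ht0 : 0 < t := NNReal.coe_pos.1 (by rw [ht]; change (0 : ℝ) < 1 / ((n : ℝ) + 1); positivity)
    have hne : pt k τ t ≠ pt k τ 0 := by
      intro h
      have : t ≤ rad (pt k τ 0) := flow_eq_self_iff.1 (by rw [flow_pt, max_eq_right zero_le, h])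
      exact (hx ▸ this).not_gt ht0
    obtain ⟨P, hP⟩ : ∃ P, (pt k τ 0).1 P < (pt k τ t).1 P := by
      by_contra! hc
      refine hne (A1an.ext fun P => le_antisymm (hc P) ?_)
      rw [pt_zero_apply]
      exact norm_aeval_le_pt τ t P
    obtain ⟨b, -, hb⟩ := exists_root_of_pt_lt ι zero_le hP
    exact ⟨b, hb⟩
  choose b hb using key
  have hlim : Tendsto (fun n => ι (b n)) atTop (𝓝 τ) := by
    rw [tendsto_iff_norm_sub_tendsto_zero]
    refine squeeze_zero (fun _ => norm_nonneg _) (fun n => ?_) tendsto_one_div_add_atTop_nhds_zero_nat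
    rw [norm_sub_rev]
    exact (hb n).le
  have hcau : CauchySeq fun n => ((b n : AlgCl k) : CompletedAlgCl k) := by
    have h1 := hlim.cauchySeq
    rw [Metric.cauchySeq_iff] at h1 ⊢
    intro ε hε
    obtain ⟨N, hN⟩ := h1 ε hε
    refine ⟨N, fun m hm n hn => ?_⟩
    have h2 := hN m hm n hn
    rw [dist_eq_norm, ← map_sub, norm_algHom] at h2
    rwa [UniformSpace.Completion.dist_eq, dist_eq_norm]
  obtain ⟨a, ha⟩ := cauchySeq_tendsto_of_complete hcau
  refine ⟨a, A1an.ext fun P => ?_⟩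
  rw [pt_zero_apply, pt_zero_apply]
  have h1 : Tendsto (fun n => ‖aeval (ι (b n)) P‖) atTop (𝓝 ‖aeval τ P‖) :=
    ((P.continuous_aeval.tendsto τ).comp hlim).norm
  have h2 : Tendsto (fun n => ‖aeval ((b n : AlgCl k) : CompletedAlgCl k) P‖) atTop
      (𝓝 ‖aeval a P‖) :=
    ((P.continuous_aeval.tendsto a).comp ha).norm
  refine tendsto_nhds_unique h1 (h2.congr fun n => ?_)
  rw [aeval_algHom_apply, norm_algHom, ← pt_zero_apply, pt_coe, pt_zero_apply]

theorem isTypeOne_coe_iff {x : A1an k} : IsTypeOne (x : P1an k) ↔ rad x = 0 := by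
  constructor
  · rintro (h | ⟨a, ha⟩)
    · exact absurd h (OnePoint.coe_ne_infty x)
    · have hx : x = pt k a 0 := OnePoint.coe_injective ha
      rw [hx, rad_pt]
  · intro h
    obtain ⟨a, rfl⟩ := exists_eq_pt_of_rad_eq_zero h
    exact Or.inr ⟨a, rfl⟩

theorem HypSpace.exists_coe (x : HypSpace k) : ∃ y : A1an k, (y : P1an k) = x.1 ∧ 0 < rad y := by
  obtain ⟨x, hx⟩ := x
  induction x using OnePoint.rec with
  | infty => exact absurd (Or.inl rfl) hx
  | coe y => exact ⟨y, rfl, pos_iff_ne_zero.2 fun h => hx (isTypeOne_coe_iff.2 h)⟩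

end TypeOne

/-! ### Compactness, and open balls of the tree -/

section Topology

variable {k : Type*} [NormedField k] [CompleteSpace k] [IsUltrametricDist k]

omit [CompleteSpace k] [IsUltrametricDist k] in
theorem isClosedEmbedding_eval :
    IsClosedEmbedding fun (x : A1an k) (P : k[X]) => x.1 P := by
  refine ⟨⟨⟨rfl⟩, fun _ _ h => A1an.ext (congr_fun h)⟩, ?_⟩
  have : Set.range (fun (x : A1an k) (P : k[X]) => x.1 P) =
      {f | f 0 = 0} ∩ {f | f 1 = 1} ∩ (⋂ P, ⋂ Q, {f | f (P + Q) ≤ f P + f Q}) ∩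
        (⋂ P, {f | f (-P) = f P}) ∩ (⋂ P, ⋂ Q, {f | f (P * Q) = f P * f Q}) ∩
        ⋂ a : k, {f | f (C a) = ‖a‖} := by
    ext f
    simp only [Set.mem_range, Set.mem_inter_iff, Set.mem_iInter, Set.mem_ofPred_eq]
    constructor
    · rintro ⟨x, rfl⟩
      exact ⟨⟨⟨⟨⟨map_zero x.1, map_one x.1⟩, map_add_le_add x.1⟩, map_neg_eq_map x.1⟩, map_mul x.1⟩,
        x.2⟩
    · rintro ⟨⟨⟨⟨⟨h0, h1⟩, h2⟩, h3⟩, h4⟩, h5⟩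
      exact ⟨⟨{ toFun := f
                map_zero' := h0
                map_one' := h1
                add_le' := h2
                neg' := h3
                map_mul' := h4 }, h5⟩, rfl⟩
  rw [this]
  refine ((((IsClosed.inter ?_ ?_).inter ?_).inter ?_).inter ?_).inter ?_
  · exact isClosed_eq (continuous_apply _) continuous_const
  · exact isClosed_eq (continuous_apply _) continuous_const
  · exact isClosed_iInter fun P => isClosed_iInter fun Q =>
      isClosed_le (continuous_apply _) (by fun_prop)
  · exact isClosed_iInter fun P => isClosed_eq (continuous_apply _) (continuous_apply _)
  · exact isClosed_iInter fun P => isClosed_iInter fun Q =>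
      isClosed_eq (continuous_apply _) (by fun_prop)
  · exact isClosed_iInter fun a => isClosed_eq (continuous_apply _) continuous_const

omit [CompleteSpace k] [IsUltrametricDist k] in
theorem isCompact_setOf_X_le (R : ℝ) : IsCompact {x : A1an k | x.1 X ≤ R} := by
  have hK : IsCompact (Set.pi Set.univ fun P : k[X] =>
      Set.Icc (0 : ℝ) (∑ i ∈ Finset.range (P.natDegree + 1), ‖P.coeff i‖ * |R| ^ i)) :=
    isCompact_univ_pi fun _ => isCompact_Icc
  refine (isClosedEmbedding_eval.isCompact_preimage hK).of_isClosed_subset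
    (isClosed_le (continuous_eval X) continuous_const) fun x hx P _ => ⟨apply_nonneg _ _, ?_⟩
  change x.1 P ≤ _
  conv_lhs => rw [P.as_sum_range_C_mul_X_pow]
  refine (Finset.le_sum_of_subadditive x.1 (map_zero x.1).le (map_add_le_add x.1) _ _).trans ?_
  refine Finset.sum_le_sum fun i _ => ?_
  rw [map_mul, map_pow, x.2]
  have : x.1 X ≤ |R| := (show x.1 X ≤ R from hx).trans (le_abs_self R)
  gcongr

instance : WeaklyLocallyCompactSpace (A1an k) :=
  ⟨fun x => ⟨{y | y.1 X ≤ x.1 X + 1}, isCompact_setOf_X_le _,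
    (continuous_eval X).continuousAt.eventually_le_const (lt_add_one _)⟩⟩

/-- The points whose join with `x` has radius less than `t` form an open set. -/
theorem isOpen_joinRad_lt {x : A1an k} {t : ℝ≥0} (ht : rad x < t) :
    IsOpen {w | joinRad w x < t} := by
  obtain ⟨s₀, h0, h0t⟩ := exists_between ht
  obtain ⟨b, hb⟩ := exists_flow_eq_pt_of_rad_lt h0
  have hflow : ∀ s, flow (pt k b 0) s = pt k b s := fun s => by
    rw [flow_pt, max_eq_right zero_le]
  have hyx : joinRad (pt k b 0) x ≤ s₀ :=
    joinRad_le_iff.2 ⟨by rw [rad_pt_algCl]; exact zero_le, h0.le, by rw [hflow, hb]⟩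
  set P := minpoly k b
  have hP : P ≠ 0 := minpoly.ne_zero (Algebra.IsAlgebraic.isAlgebraic b).isIntegral
  have hPb : aeval b P = 0 := minpoly.aeval k b
  -- The ball is cut out by a single inequality on the minimal polynomial P of b: a point joining
  -- the flow line of b before t has |P| below its value on the disk of radius t, and conversely.
  have : {w | joinRad w x < t} = {w | w.1 P < (pt k b t).1 P} := by
    ext w
    simp only [Set.mem_ofPred_eq]
    constructor
    · intro hw
      have h1 : flow w (max s₀ (joinRad w x)) = flow x (max s₀ (joinRad w x)) :=
        (joinRad_le_iff.1 (le_max_right _ _)).2.2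
      have h2 : flow x (max s₀ (joinRad w x)) = pt k b (max s₀ (joinRad w x)) := by
        rw [← flow_flow, hb, flow_pt]
      calc w.1 P ≤ (flow w (max s₀ (joinRad w x))).1 P := le_flow _ _ _
        _ = (pt k b (max s₀ (joinRad w x))).1 P := by rw [h1, h2]
        _ < _ := pt_lt_pt hP hPb (max_lt h0t hw)
    · intro hw
      suffices h : joinRad w (pt k b 0) < t from
        (joinRad_triangle _ _ _).trans_lt (max_lt h (hyx.trans_lt h0t))
      by_contra! hu
      set u := joinRad w (pt k b 0) with hu_def
      have hu0 : 0 < u := (bot_lt_of_lt ht).trans_le hu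
      -- Growth of P before time u would place w on a disk around a root of P, that is around a
      -- conjugate of b, so w would join the flow line of b before u.
      have hconst : ∀ s < u, (flow w s).1 P = w.1 P := by
        intro s hs
        refine le_antisymm ?_ (le_flow _ _ _)
        by_contra! hlt
        obtain ⟨b', hb', hb'f⟩ := exists_flow_eq_pt hlt
        rw [pt_eq_of_aeval_minpoly hb', ← hflow] at hb'f
        rcases eq_or_ne w (pt k b 0) with h | h
        · rw [hu_def, h, joinRad_self, rad_pt_algCl] at hu0
          exact lt_irrefl _ hu0
        · exact (joinRad_le_of_flow_eq h hb'f).not_gt hs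
      have hlim : Tendsto (fun s => (flow w s).1 P) (𝓝[<] u) (𝓝 ((flow w u).1 P)) :=
        (((continuous_eval P).comp (continuous_flow_right w)).tendsto u).mono_left
          nhdsWithin_le_nhds
      have : (𝓝[<] u).NeBot := nhdsLT_neBot_of_exists_lt ⟨0, hu0⟩
      have h1 : (flow w u).1 P = w.1 P := by
        refine tendsto_nhds_unique hlim (tendsto_const_nhds.congr' ?_)
        filter_upwards [self_mem_nhdsWithin] with s hs
        exact (hconst s hs).symm
      have h2 : flow w u = pt k b u := by rw [hu_def, flow_joinRad, hflow]
      rw [h2] at h1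
      have h3 : (pt k b t).1 P ≤ (pt k b u).1 P := by
        rcases hu.eq_or_lt with h | h
        · rw [h]
        · exact (pt_lt_pt hP hPb h).le
      exact (hw.trans_le (h3.trans_eq h1)).false
  rw [this]
  exact isOpen_lt (continuous_eval P) continuous_const

theorem isClosed_coe_image_flow_eq (t : ℝ≥0) (z : A1an k) :
    IsClosed ((↑) '' {w : A1an k | flow w t = z} : Set (P1an k)) := by
  have hc : IsClosed {w : A1an k | flow w t = z} :=
    isClosed_eq (continuous_flow_left t) continuous_const
  have : IsCompact {w : A1an k | flow w t = z} :=
    (isCompact_setOf_X_le (z.1 X)).of_isClosed_subset hc fun w hw => by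
      have h := le_flow w t X
      rwa [show flow w t = z from hw] at h
  exact (this.image OnePoint.continuous_coe).isClosed

end Topology

/-! ### Injective paths -/

section Arc

variable {k : Type*} [NormedField k] [CompleteSpace k] [IsUltrametricDist k]

/-- The path going up from `x` and `y` to their join. -/
def treeArc (x y : A1an k) : Set (A1an k) :=
  flow x '' Set.Iic (joinRad x y) ∪ flow y '' Set.Iic (joinRad x y)

theorem treeArc_comm (x y : A1an k) : treeArc x y = treeArc y x := by
  rw [treeArc, treeArc, joinRad_comm, Set.union_comm]

theorem joinRad_le_rad_iff {x z : A1an k} : joinRad x z ≤ rad z ↔ flow x (rad z) = z := by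
  constructor
  · intro h
    rw [(joinRad_le_iff.1 h).2.2, flow_rad]
  · intro h
    conv_lhs => rw [← h]
    rw [joinRad_flow_right, joinRad_self]
    refine max_le le_rfl ?_
    rw [← h, rad_flow]
    exact le_max_right _ _

/-- Turns betweenness into inequalities between radii, so that tree arguments become ultrametric
computations. -/
theorem mem_treeArc_iff {x y z : A1an k} : z ∈ treeArc x y ↔
    (joinRad x z ≤ rad z ∨ joinRad y z ≤ rad z) ∧ rad z ≤ joinRad x y := by
  simp only [treeArc, Set.mem_union, Set.mem_image, Set.mem_Iic]
  constructor
  · rintro (⟨t, ht, rfl⟩ | ⟨t, ht, rfl⟩)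
    · rw [joinRad_flow_right, joinRad_self, rad_flow]
      exact ⟨Or.inl le_rfl, max_le ht (rad_le_joinRad _ _)⟩
    · rw [joinRad_flow_right y, joinRad_self, rad_flow]
      exact ⟨Or.inr le_rfl, max_le ht (rad_le_joinRad' _ _)⟩
  · rintro ⟨h | h, hz⟩
    · exact Or.inl ⟨rad z, hz, joinRad_le_rad_iff.1 h⟩
    · exact Or.inr ⟨rad z, hz, joinRad_le_rad_iff.1 h⟩

theorem left_mem_treeArc (x y : A1an k) : x ∈ treeArc x y :=
  mem_treeArc_iff.2 ⟨Or.inl (joinRad_self x).le, rad_le_joinRad x y⟩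

theorem right_mem_treeArc (x y : A1an k) : y ∈ treeArc x y :=
  treeArc_comm y x ▸ left_mem_treeArc y x

/-- An outside point either does not flow to `flow x t` at time t, an open condition, or has its own
open ball of radius t, disjoint from that of x and not containing `flow x t`. -/
theorem isClosed_insert_joinRad_lt {x : A1an k} {t : ℝ≥0} (ht : rad x < t) :
    IsClosed (insert (flow x t) {w | joinRad w x < t}) := by
  have hrad : rad (flow x t) = t := by rw [rad_flow, max_eq_left ht.le]
  rw [← isOpen_compl_iff, isOpen_iff_forall_mem_open]
  intro w hw
  rw [Set.mem_compl_iff, Set.mem_insert_iff, not_or, Set.mem_ofPred_eq] at hw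
  by_cases h : flow w t = flow x t
  · have hwt : rad w < t := by
      by_contra! hc
      exact hw.1 (by rw [← h, flow_eq_of_le_rad hc])
    refine ⟨{v | joinRad v w < t}, ?_, isOpen_joinRad_lt hwt, ?_⟩
    · intro v hv
      rw [Set.mem_ofPred_eq] at hv
      rw [Set.mem_compl_iff, Set.mem_insert_iff, not_or, Set.mem_ofPred_eq]
      refine ⟨?_, fun hvx => hw.2 ?_⟩
      · rintro rfl
        exact ((rad_le_joinRad (flow x t) w).trans_lt hv).ne hrad
      · rw [joinRad_comm] at hv
        exact (joinRad_triangle w v x).trans_lt (max_lt hv hvx)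
    · rw [Set.mem_ofPred_eq, joinRad_self]
      exact hwt
  · refine ⟨{v | flow v t = flow x t}ᶜ, ?_,
      (isClosed_eq (continuous_flow_left t) continuous_const).isOpen_compl, h⟩
    rw [Set.compl_subset_compl]
    rintro v (rfl | hv)
    · rw [Set.mem_ofPred_eq, flow_flow, max_self]
    · exact (joinRad_le_iff.1 (le_of_lt hv)).2.2

theorem isClosed_coe_insert_joinRad_lt {x : A1an k} {t : ℝ≥0} (ht : rad x < t) :
    IsClosed ((↑) '' insert (flow x t) {w | joinRad w x < t} : Set (P1an k)) := by
  have hD := OnePoint.isClosed_image_coe.1 (isClosed_coe_image_flow_eq t (flow x t))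
  refine OnePoint.isClosed_image_coe.2 ⟨isClosed_insert_joinRad_lt ht,
    hD.2.of_isClosed_subset (isClosed_insert_joinRad_lt ht) ?_⟩
  rintro v (rfl | hv)
  · rw [Set.mem_ofPred_eq, flow_flow, max_self]
  · exact (joinRad_le_iff.1 (le_of_lt hv)).2.2

/-- The point `flow x t` separates the ball around x from the rest of the line, where y lies because
t ≤ J(x,y). A connected range avoiding it would stay on one side. -/
theorem flow_mem_range_path {x y : A1an k} (γ : Path (x : P1an k) (y : P1an k)) {t : ℝ≥0}
    (ht : t ≤ joinRad x y) : (flow x t : P1an k) ∈ Set.range γ := by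
  rcases le_or_gt t (rad x) with h | h
  · exact ⟨0, by rw [γ.source, flow_eq_of_le_rad h]⟩
  rcases eq_or_ne y (flow x t) with h1 | h1
  · exact ⟨1, by rw [γ.target, h1]⟩
  by_contra hz
  set U : Set (P1an k) := (↑) '' {w | joinRad w x < t}
  set W : Set (P1an k) := ((↑) '' insert (flow x t) {w | joinRad w x < t} : Set (P1an k))ᶜ
  have hU : IsOpen U := OnePoint.isOpen_image_coe.2 (isOpen_joinRad_lt h)
  have hW : IsOpen W := (isClosed_coe_insert_joinRad_lt h).isOpen_compl
  have hUW : U ⊆ Wᶜ := by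
    rw [compl_compl]
    exact Set.image_mono (Set.subset_insert _ _)
  have hdis : Disjoint U W := Set.disjoint_left.2 fun v hv hv' => hUW hv hv'
  have hcov : Set.range γ ⊆ U ∪ W := by
    intro v hv
    by_cases hvW : v ∈ W
    · exact Or.inr hvW
    · rw [Set.notMem_compl_iff] at hvW
      obtain ⟨w, rfl | hw, rfl⟩ := hvW
      · exact absurd hv hz
      · exact Or.inl ⟨w, hw, rfl⟩
  have hx : (x : P1an k) ∈ U := ⟨x, by rw [Set.mem_ofPred_eq, joinRad_self]; exact h, rfl⟩
  have hy : (y : P1an k) ∈ W := by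
    rintro ⟨w, hw, hwy⟩
    rw [OnePoint.coe_injective hwy] at hw
    rcases hw with hw | hw
    · exact h1 hw
    · rw [Set.mem_ofPred_eq, joinRad_comm] at hw
      exact hw.not_ge ht
  rcases (isPreconnected_range γ.continuous).subset_or_subset hU hW hdis hcov with hs | hs
  · exact Set.disjoint_left.1 hdis (hs ⟨1, γ.target⟩) hy
  · exact Set.disjoint_left.1 hdis hx (hs ⟨0, γ.source⟩)

theorem treeArc_subset_range_path {x y : A1an k} (γ : Path (x : P1an k) (y : P1an k))
    {z : A1an k} (hz : z ∈ treeArc x y) : (z : P1an k) ∈ Set.range γ := by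
  rcases hz with ⟨t, ht, rfl⟩ | ⟨t, ht, rfl⟩
  · exact flow_mem_range_path γ ht
  · rw [← Path.symm_range]
    exact flow_mem_range_path γ.symm (joinRad_comm x y ▸ ht)

/-- The path from `x` to `y` through their join, at parameter `0`. -/
def joinPath (x y : A1an k) (u : ℝ) : A1an k :=
  if u ≤ 0 then flow x (Real.toNNReal (joinRad x y + u))
  else flow y (Real.toNNReal (joinRad x y - u))

theorem continuous_joinPath (x y : A1an k) : Continuous (joinPath x y) := by
  refine Continuous.if_le ?_ ?_ continuous_id continuous_const ?_
  · exact (continuous_flow_right x).comp (continuous_real_toNNReal.comp (by fun_prop))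
  · exact (continuous_flow_right y).comp (continuous_real_toNNReal.comp (by fun_prop))
  · rintro u (rfl : u = 0)
    simpa using flow_joinRad x y

theorem joinPath_mem_treeArc (x y : A1an k) (u : ℝ) : joinPath x y u ∈ treeArc x y := by
  unfold joinPath
  split_ifs with h
  · exact Or.inl ⟨_, Real.toNNReal_le_iff_le_coe.2 (by linarith), rfl⟩
  · exact Or.inr ⟨_, Real.toNNReal_le_iff_le_coe.2 (by linarith), rfl⟩

theorem rad_joinPath {x y : A1an k} {u : ℝ} (h1 : (rad x : ℝ) - joinRad x y ≤ u)
    (h2 : u ≤ joinRad x y - rad y) : (rad (joinPath x y u) : ℝ) = joinRad x y - |u| := by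
  unfold joinPath
  have hx : (0 : ℝ) ≤ rad x := (rad x).2
  have hy : (0 : ℝ) ≤ rad y := (rad y).2
  split_ifs with h
  · rw [rad_flow, NNReal.coe_max, Real.coe_toNNReal _ (by linarith), abs_of_nonpos h,
      max_eq_left (by linarith)]
    ring
  · rw [rad_flow, NNReal.coe_max, Real.coe_toNNReal _ (by linarith), abs_of_pos (not_le.1 h),
      max_eq_left (by linarith)]

theorem joinPath_injOn {x y : A1an k} (hne : x ≠ y) :
    Set.InjOn (joinPath x y) (Set.Icc (rad x - joinRad x y) (joinRad x y - rad y)) := by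
  have key : ∀ u ∈ Set.Icc ((rad x : ℝ) - joinRad x y) (joinRad x y - rad y),
      ∀ v ∈ Set.Icc ((rad x : ℝ) - joinRad x y) (joinRad x y - rad y), u ≤ 0 → 0 < v →
      joinPath x y u ≠ joinPath x y v := by
    intro u hu v hv hu0 hv0 h
    have hr := rad_joinPath hu.1 hu.2
    rw [h, rad_joinPath hv.1 hv.2, abs_of_nonpos hu0, abs_of_pos hv0] at hr
    have huv : u = -v := by linarith
    rw [joinPath, joinPath, if_pos hu0, if_neg (not_le.2 hv0), huv, ← sub_eq_add_neg] at h
    have h1 := joinRad_le_of_flow_eq hne h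
    have hy : (0 : ℝ) ≤ rad y := (rad y).2
    rw [← NNReal.coe_le_coe, Real.coe_toNNReal _ (by linarith [hv.2])] at h1
    linarith
  intro u hu v hv h
  have hr := rad_joinPath hu.1 hu.2
  rw [h, rad_joinPath hv.1 hv.2] at hr
  have habs : |u| = |v| := by linarith
  rcases le_or_gt u 0 with hu0 | hu0 <;> rcases le_or_gt v 0 with hv0 | hv0
  · rw [abs_of_nonpos hu0, abs_of_nonpos hv0] at habs
    linarith
  · exact absurd h (key u hu v hv hu0 hv0)
  · exact absurd h.symm (key v hv u hu hv0 hu0)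
  · rwa [abs_of_pos hu0, abs_of_pos hv0] at habs

theorem exists_injective_path {x y : A1an k} (hne : x ≠ y) :
    ∃ γ : Path (x : P1an k) (y : P1an k), Function.Injective γ ∧
      Set.range γ = (↑) '' treeArc x y := by
  have hx : (rad x : ℝ) ≤ joinRad x y := rad_le_joinRad x y
  have hy : (rad y : ℝ) ≤ joinRad x y := rad_le_joinRad' x y
  have hpos : 0 < (joinRad x y - rad x + (joinRad x y - rad y) : ℝ) := by
    by_contra! h
    exact hne (eq_of_joinRad_le (NNReal.coe_le_coe.1 (by linarith))
      (NNReal.coe_le_coe.1 (by linarith)))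
  set ℓ : ℝ := joinRad x y - rad x + (joinRad x y - rad y) with hℓ
  let p : unitInterval → ℝ := fun i => rad x - joinRad x y + i * ℓ
  have hp : ∀ i, p i ∈ Set.Icc ((rad x : ℝ) - joinRad x y) (joinRad x y - rad y) := by
    intro i
    have h1 : (i : ℝ) * ℓ ≤ 1 * ℓ := mul_le_mul_of_nonneg_right i.2.2 hpos.le
    have h2 : 0 ≤ (i : ℝ) * ℓ := mul_nonneg i.2.1 hpos.le
    constructor
    · simp only [p]
      linarith
    · simp only [p]
      linarith
  let γ : Path (x : P1an k) (y : P1an k) :=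
    { toFun := fun i => (joinPath x y (p i) : A1an k)
      continuous_toFun := OnePoint.continuous_coe.comp
        ((continuous_joinPath x y).comp (by fun_prop))
      source' := by
        simp only [p, joinPath]
        rw [if_pos (by simpa using hx)]
        simp [flow_rad]
      target' := by
        have hp1 : p 1 = joinRad x y - rad y := by simp [p, hℓ]; ring
        rw [hp1, joinPath]
        split_ifs with h
        · have h1 : joinRad x y = rad y := le_antisymm (NNReal.coe_le_coe.1 (by linarith))
            (rad_le_joinRad' x y)
          have h2 := flow_joinRad x y
          rw [h1, flow_rad] at h2
          rw [h1]
          simp [h2]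
        · simp [flow_rad] }
  refine ⟨γ, fun i j h => ?_, Set.Subset.antisymm ?_ ?_⟩
  · have h1 := joinPath_injOn hne (hp i) (hp j) (OnePoint.coe_injective h)
    have h2 : (i : ℝ) * ℓ = j * ℓ := by simpa [p] using h1
    exact Subtype.ext (mul_right_cancel₀ hpos.ne' h2)
  · rintro _ ⟨i, rfl⟩
    exact ⟨_, joinPath_mem_treeArc x y _, rfl⟩
  · rintro _ ⟨z, hz, rfl⟩
    exact treeArc_subset_range_path γ hz

/-- The map γ⁻¹ ∘ δ is a continuous self-map of the interval fixing both ends, hence surjective. -/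
theorem range_subset_of_injective_path {X : Type*} [TopologicalSpace X] [T2Space X] {x y : X}
    {γ δ : Path x y} (hγ : Function.Injective γ) (h : Set.range δ ⊆ Set.range γ) :
    Set.range γ ⊆ Set.range δ := by
  have he := (γ.continuous.isClosedEmbedding hγ).isEmbedding
  let φ : unitInterval → unitInterval := fun i => he.toHomeomorph.symm ⟨δ i, h ⟨i, rfl⟩⟩
  have hφ : Continuous φ :=
    he.toHomeomorph.symm.continuous.comp (δ.continuous.subtype_mk _)
  have hγφ : ∀ i, γ (φ i) = δ i := fun i =>
    congr_arg Subtype.val (he.toHomeomorph.apply_symm_apply ⟨δ i, h ⟨i, rfl⟩⟩)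
  have h0 : φ 0 = 0 := hγ (by rw [hγφ, γ.source, δ.source])
  have h1 : φ 1 = 1 := hγ (by rw [hγφ, γ.target, δ.target])
  rintro _ ⟨c, rfl⟩
  obtain ⟨i, hi⟩ := intermediate_value_univ 0 1 hφ
    (show c ∈ Set.Icc (φ 0) (φ 1) by rw [h0, h1]; exact ⟨c.2.1, c.2.2⟩)
  exact ⟨i, by rw [← hγφ, hi]⟩

theorem treeArc_self (x : A1an k) : treeArc x x = {x} := by
  ext z
  rw [Set.mem_singleton_iff]
  constructor
  · rintro (⟨t, ht, rfl⟩ | ⟨t, ht, rfl⟩) <;>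
    · rw [Set.mem_Iic, joinRad_self] at ht
      exact flow_eq_of_le_rad ht
  · rintro rfl
    exact left_mem_treeArc _ _

/-- Every path covers `treeArc`, and some injective path has it as its exact range; so no injective
path has a larger range. If x = y, no path is injective and only the set {x, y} in `arc`
contributes. -/
theorem arc_coe (x y : A1an k) : arc (x : P1an k) (y : P1an k) = (↑) '' treeArc x y := by
  rcases eq_or_ne x y with rfl | hne
  · rw [treeArc_self, Set.image_singleton, arc]
    refine Set.Subset.antisymm ?_ (by simp)
    rintro z (hz | ⟨γ, hγ, -⟩)
    · simpa using hz
    · exact absurd (hγ (γ.source.trans γ.target.symm)) zero_ne_one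
  · obtain ⟨δ, hδ, hr⟩ := exists_injective_path hne
    refine Set.Subset.antisymm ?_ fun z hz => Or.inr ⟨δ, hδ, hr ▸ hz⟩
    rintro z ((rfl | rfl) | ⟨γ, hγ, hz⟩)
    · exact ⟨x, left_mem_treeArc x y, rfl⟩
    · exact ⟨y, right_mem_treeArc x y, rfl⟩
    · rw [← hr]
      refine range_subset_of_injective_path hγ ?_ hz
      rw [hr]
      rintro _ ⟨w, hw, rfl⟩
      exact treeArc_subset_range_path γ hw

end Arc

/-! ### The interval length -/

section Length

variable {k : Type*} [NormedField k] [CompleteSpace k] [IsUltrametricDist k]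

theorem diskPoint_eq_of_norm_sub_le {L : Type*} [NormedField L] [IsUltrametricDist L] {a b : L}
    {r : ℝ≥0} (h : ‖a - b‖ ≤ r) : diskPoint a r = diskPoint b r := by
  have h1 : ∀ c : L, pt L c r = diskPoint c r := fun c => A1an.ext fun P => by
    change (diskPoint c r).1 (P.map (algebraMap L L)) = _
    rw [Algebra.algebraMap_self, Polynomial.map_id]
  rw [← h1, ← h1, pt_eq_of_norm_sub_le h]

theorem norm_sub_le_of_diskPoint_eq {L : Type*} [NormedField L] [IsUltrametricDist L] {a b : L}
    {r : ℝ≥0} (h : diskPoint a r = diskPoint b r) : ‖a - b‖ ≤ r := by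
  have h1 := diskPoint_X_sub_C a b r
  rw [h, diskPoint_X_sub_C, sub_self, norm_zero, max_eq_right r.coe_nonneg] at h1
  exact h1 ▸ le_max_left _ _

/-- The length of the path from `x` to `y` through their join. -/
def treeDist (x y : A1an k) : ℝ :=
  2 * Real.log (joinRad x y) - Real.log (rad x) - Real.log (rad y)

theorem diskDist_eq (a b : CompletedAlgCl k) {r s : ℝ≥0} (hr : 0 < r) (hs : 0 < s) :
    diskDist a b r s =
      2 * Real.log (max (max r s) ‖a - b‖₊ : ℝ≥0) - Real.log r - Real.log s := by
  have hr' : (0 : ℝ) < r := hr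
  have hs' : (0 : ℝ) < s := hs
  unfold diskDist
  split_ifs with h
  · rw [max_eq_left (show ‖a - b‖₊ ≤ max r s from h), Real.log_div hr'.ne' hs'.ne']
    rcases le_total r s with hrs | hrs
    · have := Real.log_le_log hr' (NNReal.coe_le_coe.2 hrs)
      rw [max_eq_right hrs, abs_of_nonpos (by linarith)]
      ring
    · have := Real.log_le_log hs' (NNReal.coe_le_coe.2 hrs)
      rw [max_eq_left hrs, abs_of_nonneg (by linarith)]
      ring
  · push Not at h
    obtain ⟨h1, h2⟩ := max_lt_iff.1 h
    have h3 : (0 : ℝ) < ‖a - b‖ := hr'.trans h1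
    rw [max_eq_right (show max r s ≤ ‖a - b‖₊ from h.le), coe_nnnorm,
      Real.log_div h3.ne' hr'.ne', Real.log_div hs'.ne' h3.ne']
    have h4 := Real.log_lt_log hr' h1
    have h5 := Real.log_lt_log hs' h2
    rw [abs_of_pos (by linarith), abs_of_neg (by linarith)]
    ring

theorem joinRad_pt_le (a b : CompletedAlgCl k) (r s : ℝ≥0) :
    joinRad (pt k a r) (pt k b s) ≤ max (max r s) ‖a - b‖₊ := by
  have h1 : r ≤ max (max r s) ‖a - b‖₊ := (le_max_left _ _).trans (le_max_left _ _)
  have h2 : s ≤ max (max r s) ‖a - b‖₊ := (le_max_right _ _).trans (le_max_left _ _)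
  refine joinRad_le_iff.2 ⟨by rwa [rad_pt], by rwa [rad_pt], ?_⟩
  rw [flow_pt, flow_pt, max_eq_right h1, max_eq_right h2]
  refine pt_eq_of_norm_sub_le ?_
  rw [← coe_nnnorm, NNReal.coe_le_coe]
  exact le_max_right _ _

/-- As π is injective on the lifted path, its two branches cannot merge over `k` before they merge
upstairs. So the join radii agree, and the lengths with them. -/
theorem HasLength.eq_treeDist {x y : A1an k} {l : ℝ}
    (h : HasLength (x : P1an k) (y : P1an k) l) : l = treeDist x y := by
  obtain ⟨a, b, r, s, hr, hs, hx, hy, hbij, rfl⟩ := h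
  obtain rfl : pt k a r = x := OnePoint.coe_injective hx
  obtain rfl : pt k b s = y := OnePoint.coe_injective hy
  have hJ : joinRad (pt k a r) (pt k b s) = max (max r s) ‖a - b‖₊ := by
    refine le_antisymm (joinRad_pt_le a b r s) ?_
    have h1 := rad_le_joinRad (pt k a r) (pt k b s)
    have h2 := rad_le_joinRad' (pt k a r) (pt k b s)
    rw [rad_pt] at h1 h2
    refine max_le (max_le h1 h2) ?_
    by_contra! hlt
    obtain ⟨t, ht1, ht2⟩ := exists_between hlt
    have htM : t ≤ max (max r s) ‖a - b‖₊ := ht2.le.trans (le_max_right _ _)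
    have h3 : pt k a t = pt k b t := by
      have := (joinRad_le_iff.1 ht1.le).2.2
      rwa [flow_pt, flow_pt, max_eq_right (h1.trans ht1.le), max_eq_right (h2.trans ht1.le)] at this
    have h4 := hbij.injOn (Or.inl ⟨t, ⟨h1.trans ht1.le, htM⟩, rfl⟩)
      (Or.inr ⟨t, ⟨h2.trans ht1.le, htM⟩, rfl⟩) (congr_arg ((↑) : A1an k → P1an k) h3)
    exact (norm_sub_le_of_diskPoint_eq (OnePoint.coe_injective h4)).not_gt ht2
  rw [diskDist_eq a b hr hs, treeDist, hJ, rad_pt, rad_pt]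

/-- Two disk points over `k` have lifts whose centers are as close as possible. -/
theorem exists_isConjRoot_norm_sub_le (a b : AlgCl k) (r s : ℝ≥0) :
    ∃ b' : AlgCl k, pt k b' s = pt k b s ∧ ‖a - b'‖ ≤ joinRad (pt k a r) (pt k b s) := by
  set J := joinRad (pt k a r) (pt k b s) with hJ
  have hP : minpoly k b ≠ 0 := minpoly.ne_zero (Algebra.IsAlgebraic.isAlgebraic b).isIntegral
  have h1 : r ≤ J := by simpa [rad_pt_algCl] using rad_le_joinRad (pt k a r) (pt k b s)
  have h2 : s ≤ J := by simpa [rad_pt_algCl] using rad_le_joinRad' (pt k a r) (pt k b s)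
  have hflow : ∀ t, J ≤ t → pt k a t = pt k b t := by
    intro t ht
    have := (joinRad_le_iff.1 ht).2.2
    rwa [flow_pt, flow_pt, max_eq_right (h1.trans ht), max_eq_right (h2.trans ht)] at this
  classical
  -- Here b' is a conjugate of b nearest to a. Were it farther than J, the minimal polynomial would
  -- grow between J and some t < |a - b'| on disks around b, hence around a, and a nearer root would
  -- exist.
  obtain ⟨b', hb', hmin⟩ := Finset.exists_min_image
    ((minpoly k b).aroots (AlgCl k)).toFinset (fun c => ‖a - c‖)
    ⟨b, by simp [hP, minpoly.aeval]⟩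
  rw [Multiset.mem_toFinset, mem_aroots] at hb'
  refine ⟨b', pt_eq_of_aeval_minpoly hb'.2 s, ?_⟩
  by_contra! hlt
  obtain ⟨t, ht1, ht2⟩ := exists_between (show J < ‖a - b'‖₊ from hlt)
  have h3 := pt_lt_pt hP (minpoly.aeval k b) ht1
  rw [← hflow J le_rfl, ← hflow t ht1.le] at h3
  obtain ⟨c, hc, hct⟩ := exists_root_of_pt_lt (AlgHom.id k (AlgCl k)) ht1.le h3
  have h4 := hmin c (by rw [Multiset.mem_toFinset, mem_aroots]; exact ⟨hP, hc⟩)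
  exact (h4.trans_lt hct).not_gt ht2

theorem hasLength_pt (a b : AlgCl k) {r s : ℝ≥0} (hr : 0 < r) (hs : 0 < s) :
    HasLength (pt k a r : P1an k) (pt k b s : P1an k) (treeDist (pt k a r) (pt k b s)) := by
  obtain ⟨b', hb', hab⟩ := exists_isConjRoot_norm_sub_le a b r s
  rw [← hb'] at hab ⊢
  have hab' : ‖(a : CompletedAlgCl k) - b'‖₊ ≤ joinRad (pt k a r) (pt k b' s) := by
    rw [← UniformSpace.Completion.coe_sub, UniformSpace.Completion.nnnorm_coe]
    exact hab
  have hJ : max (max r s) ‖(a : CompletedAlgCl k) - b'‖₊ = joinRad (pt k a r) (pt k b' s) := by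
    refine le_antisymm (max_le (max_le ?_ ?_) hab') ?_
    · simpa [rad_pt_algCl] using rad_le_joinRad (pt k a r) (pt k b' s)
    · simpa [rad_pt_algCl] using rad_le_joinRad' (pt k a r) (pt k b' s)
    · simpa only [pt_coe] using joinRad_pt_le (a : CompletedAlgCl k) b' r s
  have hproj : ∀ (c : AlgCl k) (t : ℝ≥0),
      proj k ((diskPoint (c : CompletedAlgCl k) t : A1an (CompletedAlgCl k)) :
        P1an (CompletedAlgCl k)) = (pt k c t : P1an k) := fun c t => by
    rw [← pt_coe]
    rfl
  refine ⟨a, b', r, s, hr, hs, hproj a r, hproj b' s, ⟨?_, ?_, ?_⟩, ?_⟩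
  · rintro _ (⟨t, ⟨h1, h2⟩, rfl⟩ | ⟨t, ⟨h1, h2⟩, rfl⟩)
    · rw [hproj, arc_coe]
      exact ⟨_, Or.inl ⟨t, hJ ▸ h2, rfl⟩, by rw [flow_pt, max_eq_right h1]⟩
    · rw [hproj, arc_coe]
      exact ⟨_, Or.inr ⟨t, hJ ▸ h2, rfl⟩, by rw [flow_pt, max_eq_right h1]⟩
  · have key : ∀ t₁ ∈ Set.Icc r (max (max r s) ‖(a : CompletedAlgCl k) - b'‖₊),
        ∀ t₂ ∈ Set.Icc s (max (max r s) ‖(a : CompletedAlgCl k) - b'‖₊),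
        pt k a t₁ = pt k b' t₂ →
        diskPoint (a : CompletedAlgCl k) t₁ = diskPoint (b' : CompletedAlgCl k) t₂ := by
      intro t₁ h1 t₂ h2 h
      obtain rfl : t₁ = t₂ := by
        have := congr_arg rad h
        rwa [rad_pt_algCl, rad_pt_algCl] at this
      refine diskPoint_eq_of_norm_sub_le ?_
      have hle : joinRad (pt k a r) (pt k b' s) ≤ t₁ :=
        joinRad_le_iff.2 ⟨by rw [rad_pt_algCl]; exact h1.1, by rw [rad_pt_algCl]; exact h2.1,
          by rw [flow_pt, flow_pt, max_eq_right h1.1, max_eq_right h2.1, h]⟩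
      exact_mod_cast hab'.trans hle
    have key' : ∀ (c : AlgCl k) (t₁ t₂ : ℝ≥0), pt k c t₁ = pt k c t₂ → t₁ = t₂ := by
      intro c t₁ t₂ h
      have := congr_arg rad h
      rwa [rad_pt_algCl, rad_pt_algCl] at this
    rintro _ (⟨t₁, h1, rfl⟩ | ⟨t₁, h1, rfl⟩) _ (⟨t₂, h2, rfl⟩ | ⟨t₂, h2, rfl⟩) h <;>
      simp only [hproj] at h ⊢ <;> replace h := OnePoint.coe_injective h
    · rw [key' _ _ _ h]
    · rw [key t₁ h1 t₂ h2 h]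
    · rw [key t₂ h2 t₁ h1 h.symm]
    · rw [key' _ _ _ h]
  · rw [arc_coe]
    rintro _ ⟨z, ⟨t, ht, rfl⟩ | ⟨t, ht, rfl⟩, rfl⟩
    · refine ⟨_, Or.inl ⟨max r t, ⟨le_max_left _ _, max_le ?_ (hJ ▸ ht)⟩, rfl⟩, ?_⟩
      · exact (le_max_left _ _).trans (le_max_left _ _)
      · simp only [hproj, flow_pt]
    · refine ⟨_, Or.inr ⟨max s t, ⟨le_max_left _ _, max_le ?_ (hJ ▸ ht)⟩, rfl⟩, ?_⟩
      · exact (le_max_right _ _).trans (le_max_left _ _)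
      · simp only [hproj, flow_pt]
  · rw [diskDist_eq _ _ hr hs, hJ, treeDist, rad_pt_algCl, rad_pt_algCl]

theorem treeDist_comm (x y : A1an k) : treeDist x y = treeDist y x := by
  rw [treeDist, treeDist, joinRad_comm]
  ring

theorem treeDist_flow_flow {u v : A1an k} {s t : ℝ≥0} (hs : s ≤ joinRad u v)
    (ht : t ≤ joinRad u v) : treeDist (flow u s) (flow v t) =
      2 * Real.log (joinRad u v) - Real.log (max s (rad u) : ℝ≥0) -
        Real.log (max t (rad v) : ℝ≥0) := by
  rw [treeDist, joinRad_flow_left, joinRad_flow_right, rad_flow, rad_flow, max_eq_right ht,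
    max_eq_right hs]

theorem treeDist_flow_self_le {u v : A1an k} (hu : 0 < rad u) (hv : 0 < rad v) {s t : ℝ≥0}
    (hs : s ≤ joinRad u v) (ht : t ≤ joinRad u v) :
    treeDist (flow u s) (flow u t) ≤ treeDist u v := by
  wlog hst : s ≤ t generalizing s t
  · rw [treeDist_comm]
    exact this ht hs (le_of_not_ge hst)
  have hJ : joinRad (flow u s) (flow u t) = rad (flow u t) := by
    rw [joinRad_flow_left, joinRad_flow_right, joinRad_self, rad_flow,
      max_eq_right (hst.trans (le_max_left _ _))]
  have h1 : Real.log (rad u) ≤ Real.log (rad (flow u s)) :=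
    Real.log_le_log hu (NNReal.coe_le_coe.2 (by rw [rad_flow]; exact le_max_right _ _))
  have h2 : Real.log (rad (flow u t)) ≤ Real.log (joinRad u v) :=
    Real.log_le_log (NNReal.coe_pos.2 (by rw [rad_flow]; exact lt_max_of_lt_right hu))
      (NNReal.coe_le_coe.2 (by rw [rad_flow]; exact max_le ht (rad_le_joinRad _ _)))
  have h3 : Real.log (rad v) ≤ Real.log (joinRad u v) :=
    Real.log_le_log hv (NNReal.coe_le_coe.2 (rad_le_joinRad' u v))
  rw [treeDist, treeDist, hJ]
  linarith

theorem treeDist_flow_flow_le {u v : A1an k} (hu : 0 < rad u) (hv : 0 < rad v) {s t : ℝ≥0}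
    (hs : s ≤ joinRad u v) (ht : t ≤ joinRad u v) :
    treeDist (flow u s) (flow v t) ≤ treeDist u v := by
  rw [treeDist_flow_flow hs ht, treeDist]
  have h1 : Real.log (rad u) ≤ Real.log (max s (rad u) : ℝ≥0) :=
    Real.log_le_log hu (NNReal.coe_le_coe.2 (le_max_right _ _))
  have h2 : Real.log (rad v) ≤ Real.log (max t (rad v) : ℝ≥0) :=
    Real.log_le_log hv (NNReal.coe_le_coe.2 (le_max_right _ _))
  linarith

theorem treeDist_le_of_mem_treeArc {u v x y : A1an k} (hu : 0 < rad u) (hv : 0 < rad v)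
    (hx : x ∈ treeArc u v) (hy : y ∈ treeArc u v) : treeDist x y ≤ treeDist u v := by
  rcases hx with ⟨s, hs, rfl⟩ | ⟨s, hs, rfl⟩ <;> rcases hy with ⟨t, ht, rfl⟩ | ⟨t, ht, rfl⟩
  · exact treeDist_flow_self_le hu hv hs ht
  · exact treeDist_flow_flow_le hu hv hs ht
  · rw [treeDist_comm]
    exact treeDist_flow_flow_le hu hv ht hs
  · rw [treeDist_comm u v]
    rw [Set.mem_Iic, joinRad_comm] at hs ht
    exact treeDist_flow_self_le hv hu hs ht

/-- A point u of type 4 has no center, but raising it slightly yields a disk. If u is already the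
join, it lies on the flow line of v, which has moved since u ≠ v. -/
theorem exists_flow_min_eq_pt {u v : A1an k} (hne : u ≠ v) {ε : ℝ≥0} (hε : 0 < ε) :
    ∃ b : AlgCl k, flow u (min (rad u + ε) (joinRad u v)) =
      pt k b (min (rad u + ε) (joinRad u v)) := by
  rcases (rad_le_joinRad u v).eq_or_lt with h | h
  · rw [min_eq_right (by rw [← h]; exact le_self_add), flow_joinRad]
    refine exists_flow_eq_pt_of_rad_lt ((rad_le_joinRad' u v).lt_of_ne fun h' => hne ?_)
    exact eq_of_joinRad_le h.ge h'.ge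
  · exact exists_flow_eq_pt_of_rad_lt (lt_min (lt_add_of_pos_right _ hε) h)

/-- `HasLength` only sees points of type 2 or 3, whereas u and v may be of type 4. The supremum is
approached by raising both ends by ε along the path and letting ε tend to 0. -/
theorem rho_coe {u v : A1an k} (hu : 0 < rad u) (hv : 0 < rad v) :
    rho (u : P1an k) (v : P1an k) = ENNReal.ofReal (treeDist u v) := by
  refine le_antisymm ?_ ?_
  · refine sSup_le ?_
    rintro _ ⟨x, hx, y, hy, l, hl, rfl⟩
    rw [arc_coe] at hx hy
    obtain ⟨x, hx, rfl⟩ := hx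
    obtain ⟨y, hy, rfl⟩ := hy
    rw [hl.eq_treeDist]
    exact ENNReal.ofReal_le_ofReal (treeDist_le_of_mem_treeArc hu hv hx hy)
  rcases eq_or_ne u v with rfl | hne
  · have : treeDist u u = 0 := by rw [treeDist, joinRad_self]; ring
    simp [this]
  let p : ℝ → ℝ := fun ε => min (rad u + ε) (joinRad u v)
  let q : ℝ → ℝ := fun ε => min (rad v + ε) (joinRad u v)
  have hp0 : p 0 = rad u := by
    simp only [p, add_zero]
    exact min_eq_left (NNReal.coe_le_coe.2 (rad_le_joinRad u v))
  have hq0 : q 0 = rad v := by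
    simp only [q, add_zero]
    exact min_eq_left (NNReal.coe_le_coe.2 (rad_le_joinRad' u v))
  have hu' : (0 : ℝ) < rad u := hu
  have hv' : (0 : ℝ) < rad v := hv
  have hcont : ContinuousAt
      (fun ε => 2 * Real.log (joinRad u v) - Real.log (p ε) - Real.log (q ε)) 0 := by
    have h1 : ContinuousAt p 0 := by fun_prop
    have h2 : ContinuousAt q 0 := by fun_prop
    exact (continuousAt_const.sub (h1.log (by rw [hp0]; exact hu'.ne'))).sub
      (h2.log (by rw [hq0]; exact hv'.ne'))
  have hlim : Tendsto (fun ε => ENNReal.ofReal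
      (2 * Real.log (joinRad u v) - Real.log (p ε) - Real.log (q ε))) (𝓝[>] 0)
      (𝓝 (ENNReal.ofReal (treeDist u v))) := by
    have h1 := hcont.tendsto
    rw [hp0, hq0] at h1
    exact (ENNReal.tendsto_ofReal h1).mono_left nhdsWithin_le_nhds
  refine le_of_tendsto hlim ?_
  filter_upwards [self_mem_nhdsWithin] with ε hε
  lift ε to ℝ≥0 using (le_of_lt hε)
  have hε' : 0 < ε := hε
  obtain ⟨a, ha⟩ := exists_flow_min_eq_pt hne hε'
  obtain ⟨b, hb⟩ := exists_flow_min_eq_pt hne.symm hε'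
  rw [joinRad_comm v u] at hb
  have hpJ := min_le_right (rad u + ε) (joinRad u v)
  have hqJ := min_le_right (rad v + ε) (joinRad u v)
  have hpu : rad u ≤ min (rad u + ε) (joinRad u v) := le_min le_self_add (rad_le_joinRad u v)
  have hqv : rad v ≤ min (rad v + ε) (joinRad u v) := le_min le_self_add (rad_le_joinRad' u v)
  have hlen := hasLength_pt a b (hu.trans_le hpu) (hv.trans_le hqv)
  rw [← ha, ← hb] at hlen
  refine le_sSup ⟨_, ?_, _, ?_, _, hlen, ?_⟩
  · rw [arc_coe]
    exact ⟨_, Or.inl ⟨_, hpJ, rfl⟩, rfl⟩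
  · rw [arc_coe]
    exact ⟨_, Or.inr ⟨_, hqJ, rfl⟩, rfl⟩
  · rw [treeDist_flow_flow hpJ hqJ, max_eq_left hpu, max_eq_left hqv]
    simp [p, q]

end Length

/-! ### Retractions and Gromov products -/

section Gromov

variable {k : Type*} [NormedField k] [CompleteSpace k] [IsUltrametricDist k]

theorem treeArc_antisymm {e w z : A1an k} (h : w ∈ treeArc e z) (h' : z ∈ treeArc e w) :
    w = z := by
  obtain ⟨h1, h2⟩ := mem_treeArc_iff.1 h
  obtain ⟨h3, h4⟩ := mem_treeArc_iff.1 h'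
  have hw := rad_le_joinRad' z w
  have hz := rad_le_joinRad' w z
  rcases h1 with h1 | h1 <;> rcases h3 with h3 | h3
  · have hr : rad w = rad z := le_antisymm (h2.trans h3) (h4.trans h1)
    rw [← joinRad_le_rad_iff.1 h1, ← joinRad_le_rad_iff.1 h3, hr]
  · have hr : rad z ≤ rad w := h4.trans h1
    exact eq_of_joinRad_le (h3.trans hr) h3
  · have hr : rad w ≤ rad z := h2.trans h3
    rw [joinRad_comm] at h1
    exact eq_of_joinRad_le h1 (h1.trans hr)
  · rw [joinRad_comm] at h1
    exact eq_of_joinRad_le h1 h3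

/-- If every path from e to [x,y] passes through w₀, then `treeArc_antisymm` makes w₀ the only point
satisfying the condition in `wedge`, so the choice there is forced. -/
theorem wedge_coe {e x y w₀ : A1an k} (h1 : w₀ ∈ treeArc x y)
    (h2 : ∀ w ∈ treeArc x y, w₀ ∈ treeArc e w) :
    wedge (e : P1an k) (x : P1an k) (y : P1an k) = w₀ := by
  have h : ∃ w ∈ arc (x : P1an k) (y : P1an k),
      arc (e : P1an k) w ∩ arc (x : P1an k) (y : P1an k) = {w} := by
    refine ⟨w₀, by rw [arc_coe]; exact ⟨w₀, h1, rfl⟩, ?_⟩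
    rw [arc_coe, arc_coe, ← Set.image_inter OnePoint.coe_injective, ← Set.image_singleton]
    congr 1
    ext z
    rw [Set.mem_singleton_iff]
    constructor
    · rintro ⟨hz, hz'⟩
      exact treeArc_antisymm hz (h2 z hz')
    · rintro rfl
      exact ⟨right_mem_treeArc _ _, h1⟩
  rw [wedge, dif_pos h]
  have hmem := h.choose_spec.1
  have hinter := h.choose_spec.2
  generalize h.choose = w at hmem hinter
  rw [arc_coe] at hmem
  obtain ⟨w, hw, rfl⟩ := hmem
  rw [arc_coe, arc_coe, ← Set.image_inter OnePoint.coe_injective, ← Set.image_singleton] at hinter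
  have h3 : w₀ ∈ treeArc e w ∩ treeArc x y := ⟨h2 w hw, h1⟩
  rw [OnePoint.coe_injective.image_injective hinter] at h3
  rw [Set.mem_singleton_iff.1 h3]

theorem rad_le_joinRad_of_mem {e x w : A1an k} (h : joinRad x w ≤ rad w) :
    joinRad e x ≤ joinRad e w := by
  have h1 := joinRad_triangle e w x
  rw [joinRad_comm w x] at h1
  exact h1.trans (max_le le_rfl (h.trans (rad_le_joinRad' _ _)))

theorem min_joinRad_le_of_mem_treeArc {e x y w : A1an k} (h : w ∈ treeArc x y) :
    min (joinRad e x) (joinRad e y) ≤ joinRad e w := by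
  rcases (mem_treeArc_iff.1 h).1 with h1 | h1
  · exact (min_le_left _ _).trans (rad_le_joinRad_of_mem h1)
  · exact (min_le_right _ _).trans (rad_le_joinRad_of_mem h1)

/-- The retraction of `e` on the path from `x` to `y`, through its radius and the radius of its
join with `e`. -/
theorem exists_wedge_eq (e x y : A1an k) : ∃ w : A1an k,
    wedge (e : P1an k) (x : P1an k) (y : P1an k) = w ∧
    joinRad e w = min (joinRad e x) (joinRad e y) ∧
    rad w = min (min (joinRad e x) (joinRad e y)) (joinRad x y) := by
  have hex := rad_le_joinRad e x
  have hx := rad_le_joinRad' e x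
  have hey := rad_le_joinRad e y
  have hxy := rad_le_joinRad x y
  rcases le_total (joinRad x y) (min (joinRad e x) (joinRad e y)) with h | h
  -- Here e joins x and y at or above their own join, so the retraction is the join of x and y.
  · obtain ⟨h1, h2⟩ := le_min_iff.1 h
    have heq : joinRad e x = joinRad e y := by
      refine le_antisymm ?_ ?_
      · have := joinRad_triangle e y x
        rw [joinRad_comm y x] at this
        exact this.trans (max_le le_rfl h2)
      · exact (joinRad_triangle e x y).trans (max_le le_rfl h1)
    have hr : rad (flow x (joinRad x y)) = joinRad x y := by rw [rad_flow, max_eq_left hxy]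
    have hj : joinRad e (flow x (joinRad x y)) = joinRad e x := by
      rw [joinRad_flow_right, max_eq_right h1]
    refine ⟨flow x (joinRad x y), wedge_coe (Or.inl ⟨_, Set.self_mem_Iic, rfl⟩) fun w hw => ?_, ?_, ?_⟩
    · rw [mem_treeArc_iff, hr]
      refine ⟨Or.inr ?_, h.trans (min_joinRad_le_of_mem_treeArc hw)⟩
      obtain ⟨h3, h4⟩ := mem_treeArc_iff.1 hw
      rcases h3 with h3 | h3
      · rw [joinRad_flow_right, joinRad_comm w x]
        exact max_le le_rfl (h3.trans h4)
      · rw [flow_joinRad, joinRad_flow_right, joinRad_comm w y]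
        exact max_le le_rfl (h3.trans h4)
    · rw [hj, heq, min_self]
    · rw [hr, min_eq_right h]
  -- Here the upward path from e enters [x,y] at radius β, on the branch of the point whose join
  -- with e realizes the minimum.
  · set β := min (joinRad e x) (joinRad e y) with hβ
    have heβ : rad e ≤ β := le_min hex hey
    have hr : rad (flow e β) = β := by rw [rad_flow, max_eq_left heβ]
    have hj : joinRad e (flow e β) = β := by
      rw [joinRad_flow_right, joinRad_self, max_eq_left heβ]
    refine ⟨flow e β, wedge_coe ?_ fun w hw => ?_, hj, by rw [hr, min_eq_left h]⟩
    · rw [mem_treeArc_iff, hr]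
      refine ⟨?_, h⟩
      rcases min_choice (joinRad e x) (joinRad e y) with hc | hc
      · left
        rw [joinRad_flow_right, joinRad_comm x e, ← hc, ← hβ, max_self]
      · right
        rw [joinRad_flow_right, joinRad_comm y e, ← hc, ← hβ, max_self]
    · rw [mem_treeArc_iff, hr]
      exact ⟨Or.inl hj.le, min_joinRad_le_of_mem_treeArc hw⟩

/-- The Gromov product in terms of joins. -/
def treeProd (e x y : A1an k) : ℝ :=
  2 * Real.log (min (joinRad e x) (joinRad e y) : ℝ≥0) - Real.log (rad e) -
    Real.log (min (min (joinRad e x) (joinRad e y)) (joinRad x y) : ℝ≥0)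

theorem rho_wedge {e x y : A1an k} (he : 0 < rad e) (hx : 0 < rad x) :
    rho (e : P1an k) (wedge (e : P1an k) (x : P1an k) (y : P1an k)) =
      ENNReal.ofReal (treeProd e x y) := by
  obtain ⟨w, hw, hj, hr⟩ := exists_wedge_eq e x y
  have hwpos : 0 < rad w := by
    rw [hr]
    exact lt_min (lt_min (he.trans_le (rad_le_joinRad _ _)) (he.trans_le (rad_le_joinRad _ _)))
      (hx.trans_le (rad_le_joinRad _ _))
  rw [hw, rho_coe he hwpos, treeDist, hj, hr, treeProd]

end Gromov

/-! ### Neighborhoods of the points of type 1 -/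

section Neighborhoods

variable {k : Type*} [NormedField k] [CompleteSpace k] [IsUltrametricDist k]

theorem joinRad_le_iff_flow_eq {p w : A1an k} (hp : rad p = 0) {s : ℝ≥0} :
    joinRad w p ≤ s ↔ flow w s = flow p s := by
  refine ⟨fun h => (joinRad_le_iff.1 h).2.2, fun h => ?_⟩
  rcases eq_or_ne w p with rfl | hne
  · rw [joinRad_self, hp]
    exact zero_le
  · exact joinRad_le_of_flow_eq hne h

theorem isClosed_coe_joinRad_le {p : A1an k} (hp : rad p = 0) (s : ℝ≥0) :
    IsClosed ((↑) '' {w | joinRad w p ≤ s} : Set (P1an k)) := by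
  simp only [joinRad_le_iff_flow_eq hp]
  exact isClosed_coe_image_flow_eq s (flow p s)

theorem coe_joinRad_le_mem_nhds {p : A1an k} (hp : rad p = 0) {s : ℝ≥0} (hs : 0 < s) :
    ((↑) '' {w | joinRad w p ≤ s} : Set (P1an k)) ∈ 𝓝 (p : P1an k) := by
  refine Filter.mem_of_superset ((OnePoint.isOpen_image_coe.2
    (isOpen_joinRad_lt (hp ▸ hs : rad p < s))).mem_nhds ⟨p, ?_, rfl⟩) ?_
  · rw [Set.mem_ofPred_eq, joinRad_self, hp]
    exact hs
  · exact Set.image_mono fun w (hw : joinRad w p < s) => hw.le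

/-- The closed balls around p are compact, shrink with s and intersect in p alone, so one of them
lies in U. Taking R = `rad e` keeps the base point outside. -/
theorem exists_coe_joinRad_le_subset {p : A1an k} (hp : rad p = 0) {R : ℝ≥0} (hR : 0 < R)
    {U : Set (P1an k)} (hU : U ∈ 𝓝 (p : P1an k)) :
    ∃ s, 0 < s ∧ s < R ∧ ((↑) '' {w | joinRad w p ≤ s} : Set (P1an k)) ⊆ U := by
  have : Nonempty (Set.Ioo 0 R) := (Set.nonempty_Ioo.2 hR).to_subtype
  have hdir : Directed (· ⊇ ·)
      fun s : Set.Ioo 0 R => ((↑) '' {w | joinRad w p ≤ s} : Set (P1an k)) :=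
    Monotone.directed_ge fun s t hst =>
      Set.image_mono fun w (hw : joinRad w p ≤ s) => hw.trans hst
  obtain ⟨⟨s, hs⟩, h⟩ := exists_subset_nhds_of_isCompact hdir
    (fun s => (isClosed_coe_joinRad_le hp s).isCompact) (U := U) fun z hz => by
      rw [Set.mem_iInter] at hz
      obtain ⟨w, -, rfl⟩ := hz this.some
      have hw : ∀ s ∈ Set.Ioo 0 R, joinRad w p ≤ s := fun s hs => by
        obtain ⟨w', hw', h⟩ := hz ⟨s, hs⟩
        rwa [OnePoint.coe_injective h] at hw'
      have h0 : joinRad w p ≤ 0 := by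
        by_contra! hc
        obtain ⟨s, hs, hs'⟩ := exists_between (lt_min hc hR)
        exact (hw s ⟨hs, hs'.trans_le (min_le_right _ _)⟩).not_gt
          (hs'.trans_le (min_le_left _ _))
      rwa [eq_of_joinRad_le (h0.trans zero_le) (h0.trans zero_le)]
  exact ⟨s, hs.1, hs.2, h⟩

theorem isClosed_compl_coe_joinRad_lt {e : A1an k} {M : ℝ≥0} (hM : rad e < M) :
    IsClosed ((↑) '' {w | joinRad w e < M} : Set (P1an k))ᶜ :=
  (OnePoint.isOpen_image_coe.2 (isOpen_joinRad_lt hM)).isClosed_compl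

theorem compl_coe_joinRad_lt_mem_nhds (e : A1an k) (M : ℝ≥0) :
    ((↑) '' {w | joinRad w e < M} : Set (P1an k))ᶜ ∈ 𝓝 (OnePoint.infty : P1an k) := by
  refine Filter.mem_of_superset
    ((isClosed_coe_image_flow_eq M (flow e M)).isOpen_compl.mem_nhds ?_) ?_
  · exact OnePoint.infty_notMem_image_coe
  · exact Set.compl_subset_compl.2 (Set.image_mono fun w hw => (joinRad_le_iff.1 (le_of_lt hw)).2.2)

theorem exists_compl_coe_joinRad_lt_subset (e : A1an k) {U : Set (P1an k)}
    (hU : U ∈ 𝓝 (OnePoint.infty : P1an k)) :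
    ∃ M, rad e < M ∧ ((↑) '' {w | joinRad w e < M} : Set (P1an k))ᶜ ⊆ U := by
  have : Nonempty (Set.Ioi (rad e)) := Set.nonempty_Ioi.to_subtype
  have hdir : Directed (· ⊇ ·)
      fun M : Set.Ioi (rad e) => ((↑) '' {w | joinRad w e < M} : Set (P1an k))ᶜ :=
    Antitone.directed_ge fun s t hst => Set.compl_subset_compl.2
      (Set.image_mono fun w (hw : joinRad w e < s) => hw.trans_le hst)
  obtain ⟨⟨M, hM⟩, h⟩ := exists_subset_nhds_of_isCompact hdir
    (fun M => (isClosed_compl_coe_joinRad_lt M.2).isCompact) (U := U) fun z hz => by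
      rw [Set.mem_iInter] at hz
      induction z using OnePoint.rec with
      | infty => exact hU
      | coe w =>
        have hlt : joinRad w e < joinRad w e + 1 := lt_add_one _
        exact absurd ⟨w, hlt, rfl⟩ (hz ⟨joinRad w e + 1, (rad_le_joinRad' w e).trans_lt hlt⟩)
  exact ⟨M, hM, h⟩

end Neighborhoods

/-! ### Estimates of Gromov products -/

section Estimates

variable {k : Type*} [NormedField k] [CompleteSpace k] [IsUltrametricDist k] {e x y p : A1an k}

theorem log_coe_le {a b : ℝ≥0} (ha : 0 < a) (h : a ≤ b) : Real.log a ≤ Real.log b :=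
  Real.log_le_log (NNReal.coe_pos.2 ha) (NNReal.coe_le_coe.2 h)

theorem treeProd_le {μ ν : ℝ≥0} (he : 0 < rad e) (hν : 0 < ν)
    (h : min (joinRad e x) (joinRad e y) ≤ μ) (h1 : ν ≤ min (joinRad e x) (joinRad e y))
    (h2 : ν ≤ joinRad x y) :
    treeProd e x y ≤ 2 * Real.log μ - Real.log (rad e) - Real.log ν := by
  have hμ : 0 < min (joinRad e x) (joinRad e y) :=
    he.trans_le (le_min (rad_le_joinRad _ _) (rad_le_joinRad _ _))
  have h3 := log_coe_le hμ h
  have h4 := log_coe_le hν (le_min h1 h2)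
  rw [treeProd]
  linarith

theorem log_sub_log_le_treeProd_of_near (he : 0 < rad e) (hx : 0 < rad x) {s : ℝ≥0}
    (hxp : joinRad x p ≤ s) (hyp : joinRad y p ≤ s) :
    Real.log (rad e) - Real.log s ≤ treeProd e x y := by
  have hμ : rad e ≤ min (joinRad e x) (joinRad e y) :=
    le_min (rad_le_joinRad _ _) (rad_le_joinRad _ _)
  have hxy : joinRad x y ≤ s := (joinRad_triangle x p y).trans
    (max_le hxp (by rwa [joinRad_comm]))
  have h1 := log_coe_le he hμ
  have h2 := log_coe_le (lt_min (he.trans_le hμ) (hx.trans_le (rad_le_joinRad x y)))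
    ((min_le_right _ _).trans hxy)
  rw [treeProd]
  linarith

/-- Because x is closer to p than e and y are, p can replace x in J(e,x) and J(x,y); the bound then
depends on neither x nor y. -/
theorem treeProd_le_of_near_of_far {s : ℝ≥0} (hs : 0 < s) (hse : s < rad e)
    (hxp : joinRad x p ≤ s) (hyp : s < joinRad y p) :
    treeProd e x y ≤ 2 * Real.log (joinRad e p) - Real.log (rad e) - Real.log s := by
  have h1 : joinRad e x = joinRad e p := by
    rw [joinRad_comm e x, joinRad_comm e p]
    exact joinRad_eq_of_lt (hxp.trans_lt (hse.trans_le (rad_le_joinRad' p e)))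
  have h2 : joinRad x y = joinRad p y :=
    joinRad_eq_of_lt (hxp.trans_lt (by rwa [joinRad_comm]))
  refine treeProd_le (hs.trans hse) hs ((min_le_left _ _).trans h1.le)
    (hse.le.trans (le_min (rad_le_joinRad _ _) (rad_le_joinRad _ _))) ?_
  rw [h2, joinRad_comm]
  exact hyp.le

theorem log_sub_log_le_treeProd_of_near_infty (hx : 0 < rad x) {M : ℝ≥0}
    (hM : 0 < M) (hxe : M ≤ joinRad x e) (hye : M ≤ joinRad y e) :
    Real.log M - Real.log (rad e) ≤ treeProd e x y := by
  rw [joinRad_comm] at hxe hye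
  have h1 := log_coe_le hM (le_min hxe hye)
  have h2 := log_coe_le (lt_min (hM.trans_le (le_min hxe hye))
    (hx.trans_le (rad_le_joinRad x y))) (min_le_left _ _)
  rw [treeProd]
  linarith

/-- As J(x,y) = J(x,e) ≥ M > J(e,y), both minima in the product equal J(e,y). -/
theorem treeProd_le_of_near_infty_of_far (he : 0 < rad e) {M : ℝ≥0}
    (hxe : M ≤ joinRad x e) (hye : joinRad y e < M) :
    treeProd e x y ≤ Real.log M - Real.log (rad e) := by
  have h1 : joinRad x y = joinRad x e := by
    rw [joinRad_comm x y, joinRad_comm x e]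
    exact joinRad_eq_of_lt (hye.trans_le (by rwa [joinRad_comm]))
  have hye' : joinRad e y < M := by rwa [joinRad_comm]
  have hxe' : M ≤ joinRad e x := by rwa [joinRad_comm]
  have hpos : 0 < joinRad e y := he.trans_le (rad_le_joinRad _ _)
  have h2 := treeProd_le (e := e) (x := x) (y := y) he hpos (min_le_right _ _)
    (le_min (hye'.le.trans hxe') le_rfl) (by rw [h1]; exact hye'.le.trans hxe)
  have h3 := log_coe_le hpos hye'.le
  linarith

theorem exists_isClosed_nhd_treeProd_le {q : P1an k} (hq : IsTypeOne q) (he : 0 < rad e)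
    {U : Set (P1an k)} (hU : U ∈ 𝓝 q) :
    ∃ V : Set (P1an k), IsClosed V ∧ V ∈ 𝓝 q ∧ V ⊆ U ∧
      ∃ T : ℝ, ∀ x y : A1an k, (x : P1an k) ∈ V → (y : P1an k) ∉ V → treeProd e x y ≤ T := by
  induction q using OnePoint.rec with
  | infty =>
    obtain ⟨M, hM, hMU⟩ := exists_compl_coe_joinRad_lt_subset e hU
    refine ⟨_, isClosed_compl_coe_joinRad_lt hM, compl_coe_joinRad_lt_mem_nhds e M, hMU,
      Real.log M - Real.log (rad e), fun x y hx hy => ?_⟩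
    rw [Set.notMem_compl_iff, OnePoint.coe_injective.mem_set_image] at hy
    rw [Set.mem_compl_iff, OnePoint.coe_injective.mem_set_image, Set.mem_ofPred_eq, not_lt] at hx
    exact treeProd_le_of_near_infty_of_far he hx hy
  | coe p =>
    rw [isTypeOne_coe_iff] at hq
    obtain ⟨s, hs, hse, hsU⟩ := exists_coe_joinRad_le_subset hq he hU
    refine ⟨_, isClosed_coe_joinRad_le hq s, coe_joinRad_le_mem_nhds hq hs, hsU,
      2 * Real.log (joinRad e p) - Real.log (rad e) - Real.log s,
      fun x y hx hy => ?_⟩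
    rw [OnePoint.coe_injective.mem_set_image, Set.mem_ofPred_eq, not_le] at hy
    rw [OnePoint.coe_injective.mem_set_image, Set.mem_ofPred_eq] at hx
    exact treeProd_le_of_near_of_far hs hse hx hy

theorem exists_nhd_le_treeProd {q : P1an k} (hq : IsTypeOne q) (he : 0 < rad e) (T : ℝ) :
    ∃ V ∈ 𝓝 q, ∀ x y : A1an k, 0 < rad x → (x : P1an k) ∈ V → (y : P1an k) ∈ V →
      T ≤ treeProd e x y := by
  induction q using OnePoint.rec with
  | infty =>
    set M : ℝ≥0 := rad e * Real.toNNReal (Real.exp T) with hM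
    have hM0 : 0 < M := mul_pos he (Real.toNNReal_pos.2 (Real.exp_pos T))
    refine ⟨_, compl_coe_joinRad_lt_mem_nhds e M, fun x y hx0 hx hy => ?_⟩
    rw [Set.mem_compl_iff, OnePoint.coe_injective.mem_set_image, Set.mem_ofPred_eq, not_lt] at hx hy
    refine le_trans ?_ (log_sub_log_le_treeProd_of_near_infty hx0 hM0 hx hy)
    rw [hM, NNReal.coe_mul, Real.coe_toNNReal _ (Real.exp_pos T).le,
      Real.log_mul (NNReal.coe_pos.2 he).ne' (Real.exp_pos T).ne', Real.log_exp]
    linarith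
  | coe p =>
    rw [isTypeOne_coe_iff] at hq
    set s : ℝ≥0 := rad e * Real.toNNReal (Real.exp (-T)) with hs
    have hs0 : 0 < s := mul_pos he (Real.toNNReal_pos.2 (Real.exp_pos _))
    refine ⟨_, coe_joinRad_le_mem_nhds hq hs0, fun x y hx0 hx hy => ?_⟩
    rw [OnePoint.coe_injective.mem_set_image, Set.mem_ofPred_eq] at hx hy
    refine le_trans ?_ (log_sub_log_le_treeProd_of_near he hx0 hx hy)
    rw [hs, NNReal.coe_mul, Real.coe_toNNReal _ (Real.exp_pos _).le,
      Real.log_mul (NNReal.coe_pos.2 he).ne' (Real.exp_pos _).ne', Real.log_exp]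
    linarith

/-- A sequence which converges at infinity converges to a point of type 1. -/
theorem exists_tendsto_of_treeProd {y : ℕ → A1an k} (he : 0 < rad e)
    (h : ∀ T : ℝ, ∃ N, ∀ n ≥ N, ∀ m ≥ N, T < treeProd e (y n) (y m)) :
    ∃ q : P1an k, IsTypeOne q ∧ Tendsto (fun n => (y n : P1an k)) atTop (𝓝 q) := by
  by_cases hinf : ∀ M : ℝ≥0, ∀ᶠ n in atTop, M ≤ joinRad (y n) e
  · refine ⟨OnePoint.infty, Or.inl rfl, fun U hU => ?_⟩
    obtain ⟨M, -, hMU⟩ := exists_compl_coe_joinRad_lt_subset e hU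
    rw [mem_map]
    filter_upwards [hinf M] with n hn
    refine hMU ?_
    rw [Set.mem_compl_iff, OnePoint.coe_injective.mem_set_image, Set.mem_ofPred_eq, not_lt]
    exact hn
  push Not at hinf
  obtain ⟨M, hM⟩ := hinf
  -- One late term whose join with e is below M forces the same on all late terms, otherwise a pair
  -- would have bounded product.
  have hbdd : ∃ N, ∀ n ≥ N, joinRad (y n) e < M := by
    obtain ⟨N, hN⟩ := h (Real.log M - Real.log (rad e))
    obtain ⟨n₀, hn₀, hlt⟩ := Filter.frequently_atTop.1 hM N
    refine ⟨N, fun m hm => ?_⟩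
    by_contra! hc
    exact (hN m hm n₀ hn₀).not_ge (treeProd_le_of_near_infty_of_far he hc hlt)
  obtain ⟨N₀, hN₀⟩ := hbdd
  have hcau : ∀ s : ℝ≥0, 0 < s → ∃ N, ∀ n ≥ N, ∀ m ≥ N, joinRad (y n) (y m) ≤ s := by
    intro s hs
    obtain ⟨N, hN⟩ := h (2 * Real.log M - Real.log (rad e) - Real.log (min (rad e) s : ℝ≥0))
    refine ⟨max N N₀, fun n hn m hm => ?_⟩
    by_contra! hc
    refine (hN n (le_of_max_le_left hn) m (le_of_max_le_left hm)).not_ge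
      (treeProd_le he (lt_min he hs) ?_ ?_ ((min_le_right _ _).trans hc.le))
    · have := hN₀ n (le_of_max_le_right hn)
      rw [joinRad_comm] at this
      exact (min_le_left _ _).trans this.le
    · exact (min_le_left _ _).trans (le_min (rad_le_joinRad _ _) (rad_le_joinRad _ _))
  obtain ⟨q, hq⟩ : ∃ q : P1an k, MapClusterPt q atTop fun n => (y n : P1an k) := by
    obtain ⟨q, -, hq⟩ := isCompact_univ (X := P1an k).exists_mapClusterPt
      (f := atTop) (u := fun n => (y n : P1an k)) (by simp)
    exact ⟨q, hq⟩
  -- Late terms lie in one fibre of the flow at time s, which is closed in the projective line. So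
  -- the cluster point q lies there too; in particular it is not ∞.
  have hmem : ∀ s : ℝ≥0, 0 < s → ∃ N, (∀ n ≥ N, ∀ m ≥ N, joinRad (y n) (y m) ≤ s) ∧
      q ∈ ((↑) '' {w | flow w s = flow (y N) s} : Set (P1an k)) := by
    intro s hs
    obtain ⟨N, hN⟩ := hcau s hs
    refine ⟨N, hN, ?_⟩
    refine (isClosed_coe_image_flow_eq s (flow (y N) s)).mem_of_mapClusterPt hq ?_
    filter_upwards [eventually_ge_atTop N] with n hn
    exact ⟨y n, (joinRad_le_iff.1 (hN n hn N le_rfl)).2.2, rfl⟩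
  obtain ⟨-, -, p, -, rfl⟩ := hmem 1 one_pos
  have hmem' : ∀ s : ℝ≥0, 0 < s → rad p ≤ s ∧ ∃ N, ∀ n ≥ N, joinRad (y n) p ≤ s := by
    intro s hs
    obtain ⟨N, hN, hp⟩ := hmem s hs
    rw [OnePoint.coe_injective.mem_set_image, Set.mem_ofPred_eq] at hp
    have h1 : rad (y N) ≤ s := (rad_le_joinRad _ _).trans (hN N le_rfl N le_rfl)
    have h2 : rad p ≤ s := by
      have := congr_arg rad hp
      rw [rad_flow, rad_flow, max_eq_left h1] at this
      exact this ▸ le_max_right _ _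
    have h3 : joinRad (y N) p ≤ s := joinRad_le_iff.2 ⟨h1, h2, hp.symm⟩
    exact ⟨h2, N, fun n hn => (joinRad_triangle _ (y N) _).trans (max_le (hN n hn N le_rfl) h3)⟩
  have hp0 : rad p = 0 := by
    by_contra hne
    obtain ⟨s, hs, hs'⟩ := exists_between (pos_iff_ne_zero.2 hne)
    exact (hmem' s hs).1.not_gt hs'
  refine ⟨p, isTypeOne_coe_iff.2 hp0, fun U hU => ?_⟩
  obtain ⟨s, hs, -, hsU⟩ := exists_coe_joinRad_le_subset hp0 one_pos hU
  obtain ⟨-, N, hN⟩ := hmem' s hs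
  rw [mem_map]
  filter_upwards [eventually_ge_atTop N] with n hn
  exact hsU ⟨_, hN n hn, rfl⟩

/-! ### The Berkovich topology is coarser than the metric topology -/

/-- Since the flow is still stationary at `rad x`, each |∂ₙP|_x (rad x)ⁿ is at most |P|_x, and
passing to t costs a factor (t / rad x)ⁿ. -/
theorem flow_le_pow_mul (hx : 0 < rad x) {t : ℝ≥0} (ht : rad x ≤ t) (P : k[X]) :
    (flow x t).1 P ≤ ((t : ℝ) / rad x) ^ P.natDegree * x.1 P := by
  obtain ⟨n, hn, h⟩ := exists_flow_eq x t P
  have h1 := hasseDeriv_mul_le_flow x (rad x) P n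
  rw [flow_rad] at h1
  have hx' : (0 : ℝ) < rad x := hx
  have ht' : (rad x : ℝ) ≤ t := ht
  have h2 : 1 ≤ (t : ℝ) / rad x := (one_le_div hx').2 ht'
  calc (flow x t).1 P = ((t : ℝ) / rad x) ^ n * (x.1 (hasseDeriv n P) * (rad x : ℝ) ^ n) := by
        rw [h, div_pow]
        field_simp
    _ ≤ ((t : ℝ) / rad x) ^ n * x.1 P := by gcongr
    _ ≤ _ := by
        have := apply_nonneg x.1 P
        gcongr

/-- The join dominates y and lies on the flow line of x, and log (J / rad x) is the length of only
one half of the path. Exchanging x and y gives the two-sided comparison used for continuity. -/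
theorem apply_le_exp_treeDist_pow_mul (hx : 0 < rad x) (hy : 0 < rad y) (P : k[X]) :
    y.1 P ≤ Real.exp (treeDist x y) ^ P.natDegree * x.1 P := by
  have hJ := rad_le_joinRad x y
  have hx' : (0 : ℝ) < rad x := hx
  have hJ' : (0 : ℝ) < joinRad x y := hx.trans_le hJ
  have h1 : ((joinRad x y : ℝ) / rad x) ≤ Real.exp (treeDist x y) := by
    rw [← Real.log_le_iff_le_exp (div_pos hJ' hx'), Real.log_div hJ'.ne' hx'.ne', treeDist]
    have := log_coe_le hy (rad_le_joinRad' x y)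
    linarith
  calc y.1 P ≤ (flow y (joinRad x y)).1 P := le_flow _ _ _
    _ = (flow x (joinRad x y)).1 P := by rw [flow_joinRad]
    _ ≤ _ := flow_le_pow_mul hx hJ P
    _ ≤ _ := by
        have := apply_nonneg x.1 P
        gcongr

theorem tendsto_of_treeDist (hx : 0 < rad x) :
    Tendsto id (comap (treeDist x) (𝓝 0) ⊓ 𝓟 {y | 0 < rad y}) (𝓝 x) := by
  rw [isClosedEmbedding_eval.isInducing.tendsto_nhds_iff, tendsto_pi_nhds]
  intro P
  have hd : Tendsto (treeDist x) (comap (treeDist x) (𝓝 0) ⊓ 𝓟 {y | 0 < rad y}) (𝓝 0) :=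
    tendsto_comap.mono_left inf_le_left
  have h1 : Tendsto (fun y => Real.exp (treeDist x y) ^ P.natDegree * x.1 P)
      (comap (treeDist x) (𝓝 0) ⊓ 𝓟 {y | 0 < rad y}) (𝓝 (x.1 P)) := by
    have := (((Real.continuous_exp.tendsto 0).comp hd).pow P.natDegree).mul_const (x.1 P)
    simpa using this
  have h2 : Tendsto (fun y => Real.exp (-treeDist x y) ^ P.natDegree * x.1 P)
      (comap (treeDist x) (𝓝 0) ⊓ 𝓟 {y | 0 < rad y}) (𝓝 (x.1 P)) := by
    have := (((Real.continuous_exp.tendsto _).comp hd.neg).pow P.natDegree).mul_const (x.1 P)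
    simpa using this
  refine tendsto_of_tendsto_of_tendsto_of_le_of_le' h2 h1 ?_ ?_
  · filter_upwards [mem_inf_of_right (mem_principal_self _)] with y hy
    have h3 := apply_le_exp_treeDist_pow_mul hy hx P
    rw [treeDist_comm] at h3
    rw [Real.exp_neg, inv_pow, inv_mul_le_iff₀ (by positivity)]
    exact h3
  · filter_upwards [mem_inf_of_right (mem_principal_self _)] with y hy
    exact apply_le_exp_treeDist_pow_mul hx hy P

theorem exists_treeDist_lt_subset (hx : 0 < rad x) {U : Set (P1an k)}
    (hU : U ∈ 𝓝 (x : P1an k)) :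
    ∃ ε : ℝ, 0 < ε ∧ ∀ y : A1an k, 0 < rad y → treeDist x y < ε → (y : P1an k) ∈ U := by
  have h := tendsto_of_treeDist hx (OnePoint.continuous_coe.tendsto x hU)
  rw [mem_map, mem_inf_principal, mem_comap] at h
  obtain ⟨W, hW, hWU⟩ := h
  obtain ⟨ε, hε, hεW⟩ := Metric.mem_nhds_iff.1 hW
  refine ⟨ε, hε, fun y hy hxy => hWU (hεW ?_) hy⟩
  have h0 : 0 ≤ treeDist x y := by
    have h1 := log_coe_le hx (rad_le_joinRad x y)
    have h2 := log_coe_le hy (rad_le_joinRad' x y)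
    rw [treeDist]
    linarith
  rwa [Metric.mem_ball, Real.dist_eq, sub_zero, abs_of_nonneg h0]

end Estimates

/-! ### The comparison map -/

section Comparison

variable {k : Type*} [NormedField k] [CompleteSpace k] [IsUltrametricDist k] {η : HypSpace k}

theorem exists_isClosed_nhd_gromovProd_le (η : HypSpace k) {q : P1an k} (hq : IsTypeOne q)
    {U : Set (P1an k)} (hU : U ∈ 𝓝 q) :
    ∃ V : Set (P1an k), IsClosed V ∧ V ∈ 𝓝 q ∧ V ⊆ U ∧
      ∃ T : ℝ≥0, ∀ x y : HypSpace k, x.1 ∈ V → y.1 ∉ V → gromovProd η x y ≤ T := by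
  obtain ⟨e, he, he0⟩ := η.exists_coe
  obtain ⟨V, hVc, hV, hVU, T, hT⟩ := exists_isClosed_nhd_treeProd_le hq he0 hU
  refine ⟨V, hVc, hV, hVU, T.toNNReal, fun x y hx hy => ?_⟩
  obtain ⟨a, ha, ha0⟩ := x.exists_coe
  obtain ⟨b, hb, -⟩ := y.exists_coe
  rw [gromovProd, ← he, ← ha, ← hb, rho_wedge he0 ha0]
  exact ENNReal.ofReal_le_ofReal (hT a b (ha ▸ hx) (hb ▸ hy))

theorem exists_nhd_le_gromovProd (η : HypSpace k) {q : P1an k} (hq : IsTypeOne q) (T : ℝ≥0) :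
    ∃ V ∈ 𝓝 q, ∀ x y : HypSpace k, x.1 ∈ V → y.1 ∈ V → T ≤ gromovProd η x y := by
  obtain ⟨e, he, he0⟩ := η.exists_coe
  obtain ⟨V, hV, hT⟩ := exists_nhd_le_treeProd hq he0 T
  refine ⟨V, hV, fun x y hx hy => ?_⟩
  obtain ⟨a, ha, ha0⟩ := x.exists_coe
  obtain ⟨b, hb, -⟩ := y.exists_coe
  rw [gromovProd, ← he, ← ha, ← hb, rho_wedge he0 ha0, ← ENNReal.ofReal_coe_nnreal]
  exact ENNReal.ofReal_le_ofReal (hT a b ha0 (ha ▸ hx) (hb ▸ hy))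

theorem exists_rho_lt_subset (x : HypSpace k) {U : Set (P1an k)} (hU : U ∈ 𝓝 x.1) :
    ∃ ε : ℝ≥0∞, 0 < ε ∧ ∀ y : HypSpace k, rho x.1 y.1 < ε → y.1 ∈ U := by
  obtain ⟨a, ha, ha0⟩ := x.exists_coe
  rw [← ha] at hU ⊢
  obtain ⟨ε, hε, h⟩ := exists_treeDist_lt_subset ha0 hU
  refine ⟨ENNReal.ofReal ε, ENNReal.ofReal_pos.2 hε, fun y hy => ?_⟩
  obtain ⟨b, hb, hb0⟩ := y.exists_coe
  rw [← hb, rho_coe ha0 hb0] at hy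
  rw [← hb]
  exact h b hb0 ((ENNReal.ofReal_lt_ofReal_iff hε).1 hy)

theorem GromovSeq.exists_tendsto (x : GromovSeq η) :
    ∃ q : P1an k, IsTypeOne q ∧ Tendsto (fun n => (x.1 n).1) atTop (𝓝 q) := by
  obtain ⟨e, he, he0⟩ := η.exists_coe
  choose y hy hy0 using fun n => (x.1 n).exists_coe
  simp only [← hy]
  refine exists_tendsto_of_treeProd he0 fun T => ?_
  have h := x.2.eventually (lt_mem_nhds (ENNReal.coe_lt_top (r := T.toNNReal)))
  obtain ⟨⟨N, M⟩, hNM⟩ := eventually_atTop.1 h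
  refine ⟨max N M, fun n hn m hm => ?_⟩
  have h1 := hNM (n, m) ⟨le_of_max_le_left hn, le_of_max_le_right hm⟩
  rw [gromovProd, ← he, ← hy, ← hy, rho_wedge he0 (hy0 n)] at h1
  exact (ENNReal.ofReal_lt_ofReal_iff'.1 h1).1

theorem tendsto_gromovProd {q : P1an k} (hq : IsTypeOne q) {x y : ℕ → HypSpace k}
    (hx : Tendsto (fun n => (x n).1) atTop (𝓝 q)) (hy : Tendsto (fun n => (y n).1) atTop (𝓝 q)) :
    Tendsto (fun p : ℕ × ℕ => gromovProd η (x p.1) (y p.2)) atTop (𝓝 ⊤) := by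
  rw [ENNReal.tendsto_nhds_top_iff_nnreal]
  intro T
  obtain ⟨V, hV, h⟩ := exists_nhd_le_gromovProd η hq (T + 1)
  rw [← prod_atTop_atTop_eq]
  filter_upwards [(hx.eventually hV).prod_mk (hy.eventually hV)] with p hp
  refine lt_of_lt_of_le ?_ (h _ _ hp.1 hp.2)
  exact_mod_cast lt_add_one T

/-- If the Gromov products of two sequences exceed a bound attached to a neighborhood `U` of the
limit of the first one, the limit of the second one is in `U`. -/
theorem exists_forall_limit_mem {q : P1an k} (hq : IsTypeOne q) {U : Set (P1an k)}
    (hU : U ∈ 𝓝 q) : ∃ T : ℝ≥0, 0 < T ∧ ∀ (x y : ℕ → HypSpace k) (q' : P1an k),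
      Tendsto (fun n => (x n).1) atTop (𝓝 q) → Tendsto (fun n => (y n).1) atTop (𝓝 q') →
      (∀ᶠ p : ℕ × ℕ in atTop, T < gromovProd η (x p.1) (y p.2)) → q' ∈ U := by
  obtain ⟨V, hVc, hV, hVU, T, hT⟩ := exists_isClosed_nhd_gromovProd_le η hq hU
  -- T may be zero, while basic neighborhoods need a positive parameter.
  refine ⟨T + 1, by positivity, fun x y q' hx hy h => ?_⟩
  rw [← prod_atTop_atTop_eq] at h
  -- Currying fixes one n with xₙ in V for which the inequality holds for all large m; those yₘ then
  -- lie in the closed set V.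
  obtain ⟨n, hn, hnV⟩ := (h.curry.and (hx.eventually hV)).exists
  refine hVU (hVc.mem_of_tendsto hy (hn.mono fun m hm => ?_))
  by_contra hc
  have h1 := hm.trans_le (hT _ _ hnV hc)
  exact h1.not_ge (by exact_mod_cast (lt_add_one T).le)

theorem GromovEquiv.limit_eq {x y : GromovSeq η} (h : GromovEquiv η x y) {p q : P1an k}
    (hp : IsTypeOne p) (hx : Tendsto (fun n => (x.1 n).1) atTop (𝓝 p))
    (hy : Tendsto (fun n => (y.1 n).1) atTop (𝓝 q)) : p = q := by
  by_contra hne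
  obtain ⟨T, -, hT⟩ := exists_forall_limit_mem (η := η) hp
    (isOpen_compl_singleton.mem_nhds (show p ∈ ({q} : Set (P1an k))ᶜ from hne))
  exact hT _ _ _ hx hy (h.eventually (lt_mem_nhds ENNReal.coe_lt_top)) rfl

/-- Flow lines lead to the points of type 1: upwards from η to ∞, and downwards to a as the time
tends to 0. -/
theorem exists_seq_tendsto (η : HypSpace k) {q : P1an k} (hq : IsTypeOne q) :
    ∃ x : ℕ → HypSpace k, Tendsto (fun n => (x n).1) atTop (𝓝 q) := by
  induction q using OnePoint.rec with
  | infty =>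
    obtain ⟨e, -, he0⟩ := η.exists_coe
    refine ⟨fun n => ⟨(flow e n : A1an k), fun h => ?_⟩, ?_⟩
    · rw [isTypeOne_coe_iff, rad_flow] at h
      exact (he0.trans_le (le_max_right _ _)).ne' h
    · intro U hU
      obtain ⟨M, -, hMU⟩ := exists_compl_coe_joinRad_lt_subset e hU
      obtain ⟨N, hN⟩ := exists_nat_ge M
      rw [mem_map]
      filter_upwards [eventually_ge_atTop N] with n hn
      refine hMU ?_
      rw [Set.mem_compl_iff, OnePoint.coe_injective.mem_set_image, Set.mem_ofPred_eq, not_lt,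
        joinRad_flow_left]
      exact (hN.trans (by exact_mod_cast hn)).trans (le_max_left _ _)
  | coe a =>
    refine ⟨fun n => ⟨(flow a (1 / ((n : ℝ≥0) + 1)) : A1an k), fun h => ?_⟩, ?_⟩
    · rw [isTypeOne_coe_iff, rad_flow] at h
      exact (lt_max_of_lt_left (by positivity)).ne' h
    · have h0 : Tendsto (fun n : ℕ => 1 / ((n : ℝ≥0) + 1)) atTop (𝓝 0) :=
        tendsto_one_div_add_atTop_nhds_zero_nat
      have h1 := ((continuous_flow_right a).tendsto 0).comp h0
      rw [flow_zero] at h1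
      exact (OnePoint.continuous_coe.tendsto a).comp h1

/-- The limit in the projective line of a sequence which converges at infinity. -/
def GromovSeq.limit (x : GromovSeq η) : P1an k := x.exists_tendsto.choose

theorem GromovSeq.isTypeOne_limit (x : GromovSeq η) : IsTypeOne x.limit :=
  x.exists_tendsto.choose_spec.1

theorem GromovSeq.tendsto_limit (x : GromovSeq η) :
    Tendsto (fun n => (x.1 n).1) atTop (𝓝 x.limit) :=
  x.exists_tendsto.choose_spec.2

/-- The map from the Gromov boundary to the projective line. -/
def bdryMap (ξ : GromovBoundary η) : P1an k :=
  Quot.lift GromovSeq.limit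
    (fun x y h => h.limit_eq x.isTypeOne_limit x.tendsto_limit y.tendsto_limit) ξ

theorem isTypeOne_bdryMap (ξ : GromovBoundary η) : IsTypeOne (bdryMap ξ) := by
  induction ξ using Quot.ind with
  | mk x => exact x.isTypeOne_limit

/-- The map from the Gromov compactification to the projective line. -/
def comparison : GromovCompactification η → P1an k
  | .inner x => x.1
  | .bdry ξ => bdryMap ξ

theorem Represents.tendsto {y : ℕ → HypSpace k} {p : GromovCompactification η}
    (h : Represents y p) : Tendsto (fun n => (y n).1) atTop (𝓝 (comparison p)) := by
  cases p with
  | inner x =>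
    have : (fun n => (y n).1) = fun _ => x.1 := funext fun n => by rw [h n]
    rw [this]
    exact tendsto_const_nhds
  | bdry ξ =>
    obtain ⟨y', rfl, rfl⟩ := h
    exact y'.tendsto_limit

theorem comparison_bijective :
    Function.Bijective (comparison : GromovCompactification η → P1an k) := by
  constructor
  · rintro (x | ξ) (y | ζ) h
    · rw [show x = y from Subtype.ext h]
    · exact absurd ((show x.1 = bdryMap ζ from h) ▸ isTypeOne_bdryMap ζ) x.2
    · exact absurd ((show bdryMap ξ = y.1 from h) ▸ isTypeOne_bdryMap ξ) y.2
    · induction ξ using Quot.ind with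
      | mk x =>
        induction ζ using Quot.ind with
        | mk y =>
          congr 1
          refine Quot.sound (tendsto_gromovProd x.isTypeOne_limit x.tendsto_limit ?_)
          rw [show x.limit = y.limit from h]
          exact y.tendsto_limit
  · intro q
    by_cases hq : IsTypeOne q
    · obtain ⟨x, hx⟩ := exists_seq_tendsto η hq
      let x' : GromovSeq η := ⟨x, tendsto_gromovProd hq hx hx⟩
      exact ⟨.bdry (Quot.mk _ x'), tendsto_nhds_unique x'.tendsto_limit hx⟩
    · exact ⟨.inner ⟨q, hq⟩, rfl⟩

theorem continuous_comparison :
    Continuous (comparison : GromovCompactification η → P1an k) := by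
  refine continuous_def.2 fun U hU => ⟨fun x hx => ?_, fun ξ hξ => ?_⟩
  · exact exists_rho_lt_subset x (hU.mem_nhds hx)
  · obtain ⟨T, hT0, hT⟩ := exists_forall_limit_mem (η := η) (isTypeOne_bdryMap ξ)
      (hU.mem_nhds hξ)
    refine ⟨T, hT0, ?_⟩
    rintro p ⟨x, y, hx, hy, hp⟩
    exact hT x y _ hx.tendsto hy.tendsto (eventually_lt_of_lt_liminf hp)

theorem tendsto_bdry_of_tendsto_comparison {a : ℕ → HypSpace k} {ξ : GromovBoundary η}
    (h : Tendsto (fun n => (a n).1) atTop (𝓝 (bdryMap ξ))) :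
    Tendsto (fun n => (.inner (a n) : GromovCompactification η)) atTop (𝓝 (.bdry ξ)) := by
  rw [tendsto_nhds]
  intro W hW hξ
  obtain ⟨t, -, htW⟩ := hW.2 ξ hξ
  -- The liminf has to exceed t strictly, hence the bound t + 1.
  obtain ⟨V, hV, hVt⟩ := exists_nhd_le_gromovProd η (isTypeOne_bdryMap ξ) (t + 1)
  induction ξ using Quot.ind with
  | mk x =>
    filter_upwards [h.eventually hV] with n hn
    refine htW ⟨x.1, fun _ => a n, ⟨x, rfl, rfl⟩, fun _ => rfl, ?_⟩
    refine lt_of_lt_of_le (b := ((t + 1 : ℝ≥0) : ℝ≥0∞)) (by exact_mod_cast lt_add_one t) ?_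
    refine le_liminf_of_le (by isBoundedDefault) ?_
    have hfst : Tendsto Prod.fst (atTop : Filter (ℕ × ℕ)) atTop := by
      rw [← prod_atTop_atTop_eq]
      exact tendsto_fst
    exact (hfst.eventually (x.tendsto_limit.eventually hV)).mono fun q hq => hVt _ _ hq hn

end Comparison

end BerkovichLine

end

theorem mainTheorem11 {k : Type*} [NormedField k] [CompleteSpace k] [IsUltrametricDist k]
    (η : BerkovichLine.HypSpace k) :
    ∃ φ : BerkovichLine.GromovCompactification η → BerkovichLine.P1an k,
      Continuous φ ∧ Function.Bijective φ ∧
      (∀ x : BerkovichLine.HypSpace k, φ (.inner x) = x.1) ∧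
      (∀ x : BerkovichLine.GromovSeq η,
        Tendsto (fun n => (x.1 n).1) atTop (𝓝 (φ (.bdry (Quot.mk _ x))))) ∧
      ∀ (a : ℕ → BerkovichLine.HypSpace k) (ξ : BerkovichLine.GromovBoundary η),
        Tendsto (fun n => (.inner (a n) : BerkovichLine.GromovCompactification η)) atTop
            (𝓝 (.bdry ξ)) ↔
          Tendsto (fun n => (a n).1) atTop (𝓝 (φ (.bdry ξ))) :=
  ⟨BerkovichLine.comparison, BerkovichLine.continuous_comparison,
    BerkovichLine.comparison_bijective, fun _ => rfl, fun x => x.tendsto_limit, fun _ ξ =>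
      ⟨fun h => (BerkovichLine.continuous_comparison.tendsto (.bdry ξ)).comp h,
        BerkovichLine.tendsto_bdry_of_tendsto_comparison⟩⟩
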